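/- Let $L_2(\exp)$ be the language of second order arithmetic (number variables, set variables, $0,1,+,\cdot,<,\in$) with an additional function symbol for exponentiation. $\Sigma^0_0$ formulas have no set quantifiers and only bounded number quantifiers (free number and set variables are allowed), and $\Sigma^0_1$, $\Pi^0_1$, $\Sigma^0_2$ formulas are those of the form $\exists x\,\theta$, $\forall x\,\theta$, $\exists x\,\forall y\,\theta$ with $\theta$ in $\Sigma^0_0$. Let ${\sf RCA}_0^*$ be the theory consisting of the basic arithmetic axioms $n+1\neq 0$; $m+1=n+1\to m=n$; $m+0=m$; $m+(n+1)=(m+n)+1$; $m\cdot 0=0$; $m\cdot(n+1)=m\cdot n+m$; $\neg\, m<0$; $m<n+1\leftrightarrow(m<n\lor m=n)$, the exponentiation axioms $m^0=1$ and $m^{n+1}=m^n\cdot m$, the induction scheme for $\Sigma^0_0$ formulas, and $\Delta^0_1$ comprehension, i.e. $\forall n(\varphi(n)\leftrightarrow\psi(n))\to\exists X\,\forall n(n\in X\leftrightarrow\varphi(n))$ for $\varphi$ in $\Sigma^0_1$ and $\psi$ in $\Pi^0_1$ with $X$ not free in $\varphi$. Let ${\sf I}\Sigma^0_2$ be the scheme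 $(\varphi(0)\land\forall n(\varphi(n)\to\varphi(n+1)))\to\forall n\,\varphi(n)$ for all $\Sigma^0_2$ formulas $\varphi$, and let ${\sf ECT}$ (eventually constant palette tail) be the statement: if $f:\mathbb N\to k$ for some $k\in\mathbb N$ (that is, $f$ takes values less than $k$), then there is a $b\in\mathbb N$ such that for all $x\ge b$ there is a $y>x$ with $f(x)=f(y)$. Here functions are sets of coded ordered pairs, with $(m,n)$ coded by $(m+n)^2+m$. Then ${\sf I}\Sigma^0_2$ and ${\sf ECT}$ are equivalent over ${\sf RCA}_0^*$: ${\sf ECT}$ follows from ${\sf RCA}_0^*+{\sf I}\Sigma^0_2$, and every instance of ${\sf I}\Sigma^0_2$ follows from ${\sf RCA}_0^*+{\sf ECT}$. Here a formula follows from a theory if it is true in all (Henkin) models of the theory, which by the completeness theorem is the same as being provable in it. -/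

import Mathlib

universe u

namespace SOA

/-! ### The two-sorted language `L₂(exp)` of second order arithmetic with exponentiation -/

/-- Numerical terms; number variables are indexed by `ℕ`. -/
inductive Tm : Type
  | var (x : ℕ)
  | zero
  | one
  | add (s t : Tm)
  | mul (s t : Tm)
  | exp (s t : Tm)

/-- Formulas. Number variables and set variables are two separate families, each indexed by `ℕ`.
`allN x`, `exN x` quantify the number variable `x`; `allS X`, `exS X` the set variable `X`. -/
inductive Fml : Type
  | eq (s t : Tm)
  | lt (s t : Tm)
  | mem (t : Tm) (X : ℕ)
  | neg (φ : Fml)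
  | and (φ ψ : Fml)
  | or (φ ψ : Fml)
  | imp (φ ψ : Fml)
  | allN (x : ℕ) (φ : Fml)
  | exN (x : ℕ) (φ : Fml)
  | allS (X : ℕ) (φ : Fml)
  | exS (X : ℕ) (φ : Fml)

/-- The number variable `x` occurs in the term. -/
def Tm.Occurs (x : ℕ) : Tm → Prop
  | .var y => y = x
  | .zero => False
  | .one => False
  | .add s t => s.Occurs x ∨ t.Occurs x
  | .mul s t => s.Occurs x ∨ t.Occurs x
  | .exp s t => s.Occurs x ∨ t.Occurs x

/-- Replace the number variable `x` by the term `r`. -/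
def Tm.subst (x : ℕ) (r : Tm) : Tm → Tm
  | .var y => if y = x then r else .var y
  | .zero => .zero
  | .one => .one
  | .add s t => .add (Tm.subst x r s) (Tm.subst x r t)
  | .mul s t => .mul (Tm.subst x r s) (Tm.subst x r t)
  | .exp s t => .exp (Tm.subst x r s) (Tm.subst x r t)

namespace Fml

def iff (φ ψ : Fml) : Fml := and (imp φ ψ) (imp ψ φ)

/-- `s ≤ t` abbreviates `s < t ∨ s = t`. -/
def le (s t : Tm) : Fml := or (lt s t) (eq s t)

/-- Replace the free occurrences of the number variable `x` by the term `r`. Bound variables are not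
renamed; below only `r = 0` and `r = x + 1` are used, for which no variable can be captured, since a
free occurrence of `x` is never in the scope of a quantifier over `x`. -/
def subst (x : ℕ) (r : Tm) : Fml → Fml
  | eq s t => eq (Tm.subst x r s) (Tm.subst x r t)
  | lt s t => lt (Tm.subst x r s) (Tm.subst x r t)
  | mem t X => mem (Tm.subst x r t) X
  | neg φ => neg (φ.subst x r)
  | and φ ψ => and (φ.subst x r) (ψ.subst x r)
  | or φ ψ => or (φ.subst x r) (ψ.subst x r)
  | imp φ ψ => imp (φ.subst x r) (ψ.subst x r)
  | allN y φ => if y = x then allN y φ else allN y (φ.subst x r)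
  | exN y φ => if y = x then exN y φ else exN y (φ.subst x r)
  | allS X φ => allS X (φ.subst x r)
  | exS X φ => exS X (φ.subst x r)

/-- The set variable `X` occurs free in the formula. -/
def FreeSet (X : ℕ) : Fml → Prop
  | eq _ _ => False
  | lt _ _ => False
  | mem _ Y => Y = X
  | neg φ => φ.FreeSet X
  | and φ ψ => φ.FreeSet X ∨ ψ.FreeSet X
  | or φ ψ => φ.FreeSet X ∨ ψ.FreeSet X
  | imp φ ψ => φ.FreeSet X ∨ ψ.FreeSet X
  | allN _ φ => φ.FreeSet X
  | exN _ φ => φ.FreeSet X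
  | allS Y φ => Y ≠ X ∧ φ.FreeSet X
  | exS Y φ => Y ≠ X ∧ φ.FreeSet X

/-- `Σ⁰₀` formulas of `L₂(exp)`: no set quantifiers (set parameters are allowed), and every number
quantifier is bounded, `∀ x < t` or `∃ x < t` with `x` not occurring in `t`. -/
inductive IsSigma00 : Fml → Prop
  | eq (s t : Tm) : IsSigma00 (eq s t)
  | lt (s t : Tm) : IsSigma00 (lt s t)
  | mem (t : Tm) (X : ℕ) : IsSigma00 (mem t X)
  | neg {φ : Fml} : IsSigma00 φ → IsSigma00 (neg φ)
  | and {φ ψ : Fml} : IsSigma00 φ → IsSigma00 ψ → IsSigma00 (and φ ψ)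
  | or {φ ψ : Fml} : IsSigma00 φ → IsSigma00 ψ → IsSigma00 (or φ ψ)
  | imp {φ ψ : Fml} : IsSigma00 φ → IsSigma00 ψ → IsSigma00 (imp φ ψ)
  | ball {φ : Fml} (x : ℕ) (t : Tm) : ¬ t.Occurs x → IsSigma00 φ →
      IsSigma00 (allN x (imp (lt (.var x) t) φ))
  | bex {φ : Fml} (x : ℕ) (t : Tm) : ¬ t.Occurs x → IsSigma00 φ →
      IsSigma00 (exN x (and (lt (.var x) t) φ))

/-- `∃ x θ` with `θ` in `Σ⁰₀`. -/
def IsSigma01 (φ : Fml) : Prop := ∃ x θ, IsSigma00 θ ∧ φ = exN x θ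

/-- `∀ x θ` with `θ` in `Σ⁰₀`. -/
def IsPi01 (φ : Fml) : Prop := ∃ x θ, IsSigma00 θ ∧ φ = allN x θ

/-- `∃ x ∀ y θ` with `θ` in `Σ⁰₀`. -/
def IsSigma02 (φ : Fml) : Prop := ∃ x y θ, IsSigma00 θ ∧ φ = exN x (allN y θ)

end Fml

/-! ### Structures, truth and logical consequence -/

/-- A (Henkin) structure for `L₂(exp)`: the number variables range over `N`, the set variables over
a nonempty collection `S` of subsets of `N`. -/
structure L2Structure where
  N : Type u
  S : Set (Set N)
  S_nonempty : S.Nonempty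
  zero : N
  one : N
  add : N → N → N
  mul : N → N → N
  exp : N → N → N
  lt : N → N → Prop

namespace L2Structure

variable (M : L2Structure.{u})

/-- Value of a term under an assignment of the number variables. -/
def eval (e : ℕ → M.N) : Tm → M.N
  | .var x => e x
  | .zero => M.zero
  | .one => M.one
  | .add s t => M.add (eval e s) (eval e t)
  | .mul s t => M.mul (eval e s) (eval e t)
  | .exp s t => M.exp (eval e s) (eval e t)

/-- Satisfaction, for assignments `e` of the number variables and `E` of the set variables. -/
def Sat : Fml → (ℕ → M.N) → (ℕ → Set M.N) → Prop
  | .eq s t, e, _ => M.eval e s = M.eval e t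
  | .lt s t, e, _ => M.lt (M.eval e s) (M.eval e t)
  | .mem t X, e, E => M.eval e t ∈ E X
  | .neg φ, e, E => ¬ Sat φ e E
  | .and φ ψ, e, E => Sat φ e E ∧ Sat ψ e E
  | .or φ ψ, e, E => Sat φ e E ∨ Sat ψ e E
  | .imp φ ψ, e, E => Sat φ e E → Sat ψ e E
  | .allN x φ, e, E => ∀ a : M.N, Sat φ (Function.update e x a) E
  | .exN x φ, e, E => ∃ a : M.N, Sat φ (Function.update e x a) E
  | .allS X φ, e, E => ∀ A ∈ M.S, Sat φ e (Function.update E X A)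
  | .exS X φ, e, E => ∃ A ∈ M.S, Sat φ e (Function.update E X A)

/-- A formula is true in `M` if it holds under all assignments of numbers of `M` and sets of `M` to
its free variables, that is, if its universal closure holds in `M`. -/
def IsTrue (φ : Fml) : Prop :=
  ∀ (e : ℕ → M.N) (E : ℕ → Set M.N), (∀ X, E X ∈ M.S) → M.Sat φ e E

/-- `M` is a model of the theory (set of axioms) `T`. -/
def IsModel (T : Set Fml) : Prop := ∀ φ ∈ T, M.IsTrue φ

end L2Structure

/-- `φ` follows from `T`: it is true in all models of `T`. By the completeness theorem this is the
same as provability of `φ` in `T`. -/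
def Entails (T : Set Fml) (φ : Fml) : Prop :=
  ∀ M : L2Structure.{u}, M.IsModel T → M.IsTrue φ

/-- The sets of axioms `A` and `B` are equivalent over the base theory `T`: each axiom of `B`
follows from `T + A`, and each axiom of `A` follows from `T + B`. -/
def EquivalentOver (T A B : Set Fml) : Prop :=
  (∀ φ ∈ B, Entails.{u} (T ∪ A) φ) ∧ (∀ φ ∈ A, Entails.{u} (T ∪ B) φ)

/-! ### The axioms of `RCA₀*`, and `Σ⁰₂` induction -/

section Axioms

open Fml

/-- Basic arithmetic axioms, with `m`, `n` the number variables `0`, `1`. -/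
def basicAxioms : Set Fml :=
  let m : Tm := .var 0
  let n : Tm := .var 1
  { neg (eq (.add n .one) .zero),
    imp (eq (.add m .one) (.add n .one)) (eq m n),
    eq (.add m .zero) m,
    eq (.add m (.add n .one)) (.add (.add m n) .one),
    eq (.mul m .zero) .zero,
    eq (.mul m (.add n .one)) (.add (.mul m n) m),
    neg (lt m .zero),
    iff (lt m (.add n .one)) (or (lt m n) (eq m n)) }

/-- `m ^ 0 = 1` and `m ^ (n + 1) = m ^ n * m`. -/
def expAxioms : Set Fml :=
  let m : Tm := .var 0
  let n : Tm := .var 1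
  { eq (.exp m .zero) .one,
    eq (.exp m (.add n .one)) (.mul (.exp m n) m) }

/-- `(φ(0) ∧ ∀ x (φ(x) → φ(x + 1))) → ∀ x φ(x)`. -/
def inductionAxiom (x : ℕ) (φ : Fml) : Fml :=
  imp (and (φ.subst x .zero) (allN x (imp φ (φ.subst x (.add (.var x) .one))))) (allN x φ)

/-- The induction scheme for `Σ⁰₀` formulas. -/
def ISigma00 : Set Fml := {χ | ∃ x φ, IsSigma00 φ ∧ χ = inductionAxiom x φ}

/-- The induction scheme for `Σ⁰₂` formulas. -/
def ISigma02 : Set Fml := {χ | ∃ x φ, IsSigma02 φ ∧ χ = inductionAxiom x φ}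

/-- `∀ x (φ(x) ↔ ψ(x)) → ∃ X ∀ x (x ∈ X ↔ φ(x))`, for `φ` in `Σ⁰₁` and `ψ` in `Π⁰₁`, where `X` is
not free in `φ`. -/
def delta01Comprehension : Set Fml :=
  {χ | ∃ x X φ ψ, IsSigma01 φ ∧ IsPi01 ψ ∧ ¬ φ.FreeSet X ∧
    χ = imp (allN x (iff φ ψ)) (exS X (allN x (iff (mem (.var x) X) φ)))}

/-- The theory `RCA₀*`. -/
def RCA0Star : Set Fml := basicAxioms ∪ expAxioms ∪ ISigma00 ∪ delta01Comprehension

/-- The usual code `(s + t)² + s` of the ordered pair `(s, t)`. -/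
def pair (s t : Tm) : Tm := .add (.mul (.add s t) (.add s t)) s

/-- The set variable `F` is (the graph of) a function from the numbers to the numbers below
the number variable `0`: every element of `F` is a pair `(x, y)` with `y < k`, and for every `x`
there is exactly one `y` with `(x, y) ∈ F`. The variables `10, …, 13` are bound. -/
def isColoring (F : ℕ) : Fml :=
  let k : Tm := .var 0
  let x : Tm := .var 10
  let y : Tm := .var 11
  let y' : Tm := .var 12
  let z : Tm := .var 13
  and (allN 13 (imp (mem z F) (exN 10 (exN 11 (and (lt y k) (eq z (pair x y)))))))
    (and (allN 10 (exN 11 (mem (pair x y) F)))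
      (allN 10 (allN 11 (allN 12 (imp (and (mem (pair x y) F) (mem (pair x y') F)) (eq y y'))))))

/-- The principle `ECT`: for all `k` and all `f : ℕ → k` there is `b` such that for all `x ≥ b`
there is `y > x` with `f(x) = f(y)`, that is, with `(x, j) ∈ f` and `(y, j) ∈ f` for some `j`. -/
def ECT : Fml :=
  let b : Tm := .var 1
  let x : Tm := .var 2
  let y : Tm := .var 3
  let j : Tm := .var 4
  allN 0 (allS 0 (imp (isColoring 0)
    (exN 1 (allN 2 (imp (le b x)
      (exN 3 (and (lt x y) (exN 4 (and (mem (pair x j) 0) (mem (pair y j) 0))))))))))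

end Axioms

end SOA

/-! Both directions are argued inside an arbitrary model. From Σ⁰₂ induction to `ECT`: if a
colouring with `k` colours violates `ECT`, then beyond every `b` some colour makes its last
appearance. Let the binary digits of `s < 2^k` code a set of colours that no longer appear from `b`
on. If `x ≥ b` is the last appearance of colour `j`, then `j` is not in `s`, so `s + 2^j` arises
without carry and codes a set of colours absent from `x + 1` on. Hence Σ⁰₂ induction gives, for
every `n`, such a pair `b`, `s` with `n ≤ s < 2^k`, which is absurd for `n = 2^k`. Measuring the set
by its code makes counting its elements unnecessary. From `ECT` to Σ⁰₂ induction: by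
`ECTHolds.exists_bound` the colours seen beyond a suitable `b` are exactly those seen unboundedly
often, so a Π⁰₂ property of colours becomes Σ⁰₁. This first yields `ECTHolds.sigma1_induction`. For
a Σ⁰₂ property `∃ x ∀ y R n x y`, call a stage an event for `n` when a further initial segment of
candidates `x` has just been refuted; the property fails at `n` iff the events for `n` are
unbounded. Colouring the pair `(m, u)` by `m` when `u` is an event for `m ≤ k` makes failure at `m ≤
k` a Σ⁰₁ condition, and Σ⁰₁ induction carries a failure at `k` down to `0`. The schemes speak of
formulas only. `Sig0` collects the properties definable by Σ⁰₀ formulas with parameters, and its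
closure rules replace writing the formulas out. -/

namespace SOA

/-! ### Syntactic preliminaries -/

open Function

/-- Simultaneous substitution of terms for all number variables. -/
def Tm.bind (σ : ℕ → Tm) : Tm → Tm
  | .var y => σ y
  | .zero => .zero
  | .one => .one
  | .add s t => .add (s.bind σ) (t.bind σ)
  | .mul s t => .mul (s.bind σ) (t.bind σ)
  | .exp s t => .exp (s.bind σ) (t.bind σ)

theorem Tm.occurs_bind {σ : ℕ → Tm} {x : ℕ} {t : Tm} (h : (t.bind σ).Occurs x) :
    ∃ i, t.Occurs i ∧ (σ i).Occurs x := by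
  induction t with
  | var y => exact ⟨y, rfl, h⟩
  | zero => exact h.elim
  | one => exact h.elim
  | add s t hs ht | mul s t hs ht | exp s t hs ht =>
    rcases h with h | h
    · obtain ⟨i, hi, hx⟩ := hs h
      exact ⟨i, .inl hi, hx⟩
    · obtain ⟨i, hi, hx⟩ := ht h
      exact ⟨i, .inr hi, hx⟩

theorem Tm.exists_bound (t : Tm) : ∃ K, ∀ x, t.Occurs x → x < K := by
  induction t with
  | var y => exact ⟨y + 1, fun x h => by simp only [Tm.Occurs] at h; omega⟩
  | zero => exact ⟨0, fun x h => h.elim⟩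
  | one => exact ⟨0, fun x h => h.elim⟩
  | add s t hs ht | mul s t hs ht | exp s t hs ht =>
    obtain ⟨K, hK⟩ := hs
    obtain ⟨L, hL⟩ := ht
    refine ⟨max K L, fun x h => ?_⟩
    rcases h with h | h
    · exact lt_max_of_lt_left (hK x h)
    · exact lt_max_of_lt_right (hL x h)

theorem Fml.exists_not_freeSet (φ : Fml) : ∃ K, ∀ X, K ≤ X → ¬ φ.FreeSet X := by
  induction φ with
  | eq s t => exact ⟨0, fun X _ h => h⟩
  | lt s t => exact ⟨0, fun X _ h => h⟩
  | mem t Y => exact ⟨Y + 1, fun X hX h => by simp only [Fml.FreeSet] at h; omega⟩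
  | neg φ h | allN x φ h | exN x φ h => exact h
  | and φ ψ h₁ h₂ | or φ ψ h₁ h₂ | imp φ ψ h₁ h₂ =>
    obtain ⟨K, hK⟩ := h₁
    obtain ⟨L, hL⟩ := h₂
    refine ⟨max K L, fun X hX h => ?_⟩
    rcases h with h | h
    · exact hK X (le_trans (le_max_left _ _) hX) h
    · exact hL X (le_trans (le_max_right _ _) hX) h
  | allS Y φ h | exS Y φ h =>
    obtain ⟨K, hK⟩ := h
    exact ⟨K, fun X hX h => hK X hX h.2⟩

/-! ### Satisfaction and substitution -/

namespace L2Structure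

variable {M : L2Structure.{u}}

theorem eval_congr {e e' : ℕ → M.N} {t : Tm} (h : ∀ x, t.Occurs x → e x = e' x) :
    M.eval e t = M.eval e' t := by
  induction t with
  | var y => exact h y rfl
  | zero => rfl
  | one => rfl
  | add s t hs ht | mul s t hs ht | exp s t hs ht =>
    simp only [eval]
    rw [hs fun x hx => h x (.inl hx), ht fun x hx => h x (.inr hx)]

theorem eval_update_of_not_occurs {e : ℕ → M.N} {t : Tm} {x : ℕ} (h : ¬ t.Occurs x) (a : M.N) :
    M.eval (update e x a) t = M.eval e t :=
  eval_congr fun y hy => update_of_ne (by rintro rfl; exact h hy) _ _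

theorem eval_subst (e : ℕ → M.N) (x : ℕ) (r t : Tm) :
    M.eval e (Tm.subst x r t) = M.eval (update e x (M.eval e r)) t := by
  induction t with
  | var y =>
    by_cases h : y = x
    · subst h; simp [Tm.subst, eval]
    · simp [Tm.subst, eval, h]
  | zero => rfl
  | one => rfl
  | add s t hs ht | mul s t hs ht | exp s t hs ht => simp only [Tm.subst, eval, hs, ht]

theorem eval_bind (e : ℕ → M.N) (σ : ℕ → Tm) (t : Tm) :
    M.eval e (t.bind σ) = M.eval (fun i => M.eval e (σ i)) t := by
  induction t with
  | var y => rfl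
  | zero => rfl
  | one => rfl
  | add s t hs ht | mul s t hs ht | exp s t hs ht => simp only [Tm.bind, eval, hs, ht]

theorem sat_subst {x : ℕ} {r : Tm} (hr : ∀ y, r.Occurs y → y = x) (φ : Fml) (e : ℕ → M.N)
    (E : ℕ → Set M.N) :
    M.Sat (φ.subst x r) e E ↔ M.Sat φ (update e x (M.eval e r)) E := by
  have key : ∀ (y : ℕ) (e : ℕ → M.N) (a : M.N), y ≠ x →
      update (update e y a) x (M.eval (update e y a) r) =
        update (update e x (M.eval e r)) y a := by
    intro y e a h
    rw [eval_update_of_not_occurs fun hy => h (hr y hy), update_comm h]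
  induction φ generalizing e E with
  | eq s t | lt s t => simp only [Fml.subst, Sat, eval_subst]
  | mem t Y => simp only [Fml.subst, Sat, eval_subst]
  | neg φ h => simp only [Fml.subst, Sat, h]
  | and φ ψ h₁ h₂ | or φ ψ h₁ h₂ | imp φ ψ h₁ h₂ => simp only [Fml.subst, Sat, h₁, h₂]
  | allN y φ h | exN y φ h =>
    by_cases hy : y = x
    · subst hy; simp [Fml.subst, Sat]
    · simp only [Fml.subst, hy, if_false, Sat, h, key y e _ hy]
  | allS Y φ h | exS Y φ h => simp only [Fml.subst, Sat, h]

-- Only finitely many variables matter. This allows a substitution to be truncated to finitely many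
-- variables, and supplies dummy number variables.
variable (M) in
theorem exists_support (φ : Fml) : ∃ K, ∀ (e e' : ℕ → M.N) (E : ℕ → Set M.N),
    (∀ i < K, e i = e' i) → (M.Sat φ e E ↔ M.Sat φ e' E) := by
  induction φ with
  | eq s t | lt s t =>
    obtain ⟨K, hK⟩ := s.exists_bound
    obtain ⟨L, hL⟩ := t.exists_bound
    refine ⟨max K L, fun e e' E h => ?_⟩
    simp only [Sat]
    rw [eval_congr fun x hx => h x (lt_max_of_lt_left (hK x hx)),
      eval_congr fun x hx => h x (lt_max_of_lt_right (hL x hx))]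
  | mem t Y =>
    obtain ⟨K, hK⟩ := t.exists_bound
    refine ⟨K, fun e e' E h => ?_⟩
    simp only [Sat]
    rw [eval_congr fun x hx => h x (hK x hx)]
  | neg φ h =>
    obtain ⟨K, hK⟩ := h
    exact ⟨K, fun e e' E h => not_congr (hK e e' E h)⟩
  | and φ ψ h₁ h₂ | or φ ψ h₁ h₂ | imp φ ψ h₁ h₂ =>
    obtain ⟨K, hK⟩ := h₁
    obtain ⟨L, hL⟩ := h₂
    refine ⟨max K L, fun e e' E h => ?_⟩
    simp only [Sat]
    rw [hK e e' E fun i hi => h i (lt_max_of_lt_left hi),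
      hL e e' E fun i hi => h i (lt_max_of_lt_right hi)]
  | allN x φ h =>
    obtain ⟨K, hK⟩ := h
    refine ⟨K, fun e e' E h => forall_congr' fun a => hK _ _ E fun i hi => ?_⟩
    by_cases hx : i = x
    · subst hx; simp
    · simp [hx, h i hi]
  | exN x φ h =>
    obtain ⟨K, hK⟩ := h
    refine ⟨K, fun e e' E h => exists_congr fun a => hK _ _ E fun i hi => ?_⟩
    by_cases hx : i = x
    · subst hx; simp
    · simp [hx, h i hi]
  | allS X φ h =>
    obtain ⟨K, hK⟩ := h
    exact ⟨K, fun e e' E h => forall_congr' fun A => imp_congr_right fun _ => hK _ _ _ h⟩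
  | exS X φ h =>
    obtain ⟨K, hK⟩ := h
    exact ⟨K, fun e e' E h => exists_congr fun A => and_congr_right fun _ => hK _ _ _ h⟩

theorem sat_congr_set {φ : Fml} {e : ℕ → M.N} {E E' : ℕ → Set M.N}
    (h : ∀ X, φ.FreeSet X → E X = E' X) : M.Sat φ e E ↔ M.Sat φ e E' := by
  induction φ generalizing e E E' with
  | eq s t | lt s t => rfl
  | mem t Y => simp only [Sat]; rw [h Y rfl]
  | neg φ ih => exact not_congr (ih h)
  | and φ ψ h₁ h₂ | or φ ψ h₁ h₂ | imp φ ψ h₁ h₂ =>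
    simp only [Sat]
    rw [h₁ fun X hX => h X (.inl hX), h₂ fun X hX => h X (.inr hX)]
  | allN x φ ih => exact forall_congr' fun a => ih h
  | exN x φ ih => exact exists_congr fun a => ih h
  | allS Y φ ih =>
    refine forall_congr' fun A => imp_congr_right fun _ => ih fun X hX => ?_
    by_cases hY : X = Y
    · subst hY; simp
    · simp [hY, h X ⟨Ne.symm hY, hX⟩]
  | exS Y φ ih =>
    refine exists_congr fun A => and_congr_right fun _ => ih fun X hX => ?_
    by_cases hY : X = Y
    · subst hY; simp
    · simp [hY, h X ⟨Ne.symm hY, hX⟩]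

variable {E : ℕ → Set M.N}

/-- Each bound variable is renamed to `B`, which occurs in no substituted term, so nothing is
captured; below the quantifier the bound grows to `B + 1`. -/
theorem exists_bind_of_bounded {φ : Fml} (hφ : φ.IsSigma00) (σ : ℕ → Tm) (B : ℕ)
    (hB : ∀ i x, (σ i).Occurs x → x < B) :
    ∃ φ' : Fml, φ'.IsSigma00 ∧
      ∀ e, M.Sat φ' e E ↔ M.Sat φ (fun i => M.eval e (σ i)) E := by
  induction hφ generalizing σ B with
  | eq s t => exact ⟨.eq (s.bind σ) (t.bind σ), .eq _ _, fun e => by simp only [Sat, eval_bind]⟩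
  | lt s t => exact ⟨.lt (s.bind σ) (t.bind σ), .lt _ _, fun e => by simp only [Sat, eval_bind]⟩
  | mem t X => exact ⟨.mem (t.bind σ) X, .mem _ _, fun e => by simp only [Sat, eval_bind]⟩
  | neg _ ih =>
    obtain ⟨φ, h, hs⟩ := ih σ B hB
    exact ⟨φ.neg, h.neg, fun e => by simp only [Sat, hs]⟩
  | and _ _ ih₁ ih₂ =>
    obtain ⟨φ, h, hs⟩ := ih₁ σ B hB
    obtain ⟨ψ, h', hs'⟩ := ih₂ σ B hB
    exact ⟨φ.and ψ, h.and h', fun e => by simp only [Sat, hs, hs']⟩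
  | or _ _ ih₁ ih₂ =>
    obtain ⟨φ, h, hs⟩ := ih₁ σ B hB
    obtain ⟨ψ, h', hs'⟩ := ih₂ σ B hB
    exact ⟨φ.or ψ, h.or h', fun e => by simp only [Sat, hs, hs']⟩
  | imp _ _ ih₁ ih₂ =>
    obtain ⟨φ, h, hs⟩ := ih₁ σ B hB
    obtain ⟨ψ, h', hs'⟩ := ih₂ σ B hB
    exact ⟨φ.imp ψ, h.imp h', fun e => by simp only [Sat, hs, hs']⟩
  | ball x t ht _ ih | bex x t ht _ ih =>
    have hB' : ∀ i y, (update σ x (.var B) i).Occurs y → y < B + 1 := by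
      intro i y hy
      by_cases hi : i = x
      · subst hi
        rw [update_self] at hy
        simp only [Tm.Occurs] at hy
        omega
      · rw [update_of_ne hi] at hy
        exact Nat.lt_succ_of_lt (hB i y hy)
    obtain ⟨φ, h, hs⟩ := ih (update σ x (.var B)) (B + 1) hB'
    have ho : ¬ (t.bind σ).Occurs B := fun hb => by
      obtain ⟨i, _, hi⟩ := Tm.occurs_bind hb
      exact lt_irrefl _ (hB i B hi)
    have henv : ∀ (e : ℕ → M.N) (a : M.N),
        (fun i => M.eval (update e B a) (update σ x (.var B) i)) =
          update (fun i => M.eval e (σ i)) x a := by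
      intro e a
      funext i
      by_cases hi : i = x
      · subst hi; simp [eval]
      · rw [update_of_ne hi, update_of_ne hi]
        exact eval_update_of_not_occurs (fun hb => lt_irrefl _ (hB i B hb)) a
    have hsat : ∀ (e : ℕ → M.N) (a : M.N), (M.lt a (M.eval (update e B a) (t.bind σ)) ↔
        M.lt a (M.eval (update (fun i => M.eval e (σ i)) x a) t)) ∧ (M.Sat φ (update e B a) E ↔
          M.Sat _ (update (fun i => M.eval e (σ i)) x a) E) := fun e a => by
      rw [hs, henv, eval_update_of_not_occurs ho, eval_update_of_not_occurs ht, eval_bind]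
      exact ⟨.rfl, .rfl⟩
    first
    | refine ⟨_, .ball B (t.bind σ) ho h, fun e => forall_congr' fun a => ?_⟩
      simp only [Sat, hsat, eval, update_self]
    | refine ⟨_, .bex B (t.bind σ) ho h, fun e => exists_congr fun a => ?_⟩
      simp only [Sat, hsat, eval, update_self]

theorem exists_bind {φ : Fml} (hφ : φ.IsSigma00) (σ : ℕ → Tm) :
    ∃ φ' : Fml, φ'.IsSigma00 ∧
      ∀ e, M.Sat φ' e E ↔ M.Sat φ (fun i => M.eval e (σ i)) E := by
  obtain ⟨K, hK⟩ := M.exists_support φ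
  choose b hb using fun i => (σ i).exists_bound
  obtain ⟨φ', h, hs⟩ := exists_bind_of_bounded (M := M) (E := E) hφ
    (fun i => if i < K then σ i else .zero) ((Finset.range K).sup b) (by
      intro i x hx
      split_ifs at hx with hi
      · exact lt_of_lt_of_le (hb i x hx) (Finset.le_sup (Finset.mem_range.2 hi))
      · exact hx.elim)
  refine ⟨φ', h, fun e => (hs e).trans (hK _ _ _ fun i hi => ?_)⟩
  simp [hi]

/-! ### Definability by `Σ⁰₀` formulas with number parameters -/

/-- The assignment that lists the values of `e` at the even and those of `p` at the odd
variables. -/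
def merge (e p : ℕ → M.N) : ℕ → M.N := fun i => if i % 2 = 0 then e (i / 2) else p (i / 2)

@[simp] theorem merge_even (e p : ℕ → M.N) (i : ℕ) : merge e p (2 * i) = e i := by simp [merge]

@[simp] theorem merge_odd (e p : ℕ → M.N) (i : ℕ) : merge e p (2 * i + 1) = p i := by
  have h₁ : (2 * i + 1) % 2 = 1 := by omega
  have h₂ : (2 * i + 1) / 2 = i := by omega
  simp [merge, h₁, h₂]

theorem merge_update (e p : ℕ → M.N) (i : ℕ) (a : M.N) :
    merge (update e i a) p = update (merge e p) (2 * i) a := by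
  funext j
  obtain ⟨j, rfl | rfl⟩ := Nat.even_or_odd' j
  · by_cases h : j = i
    · subst h; simp
    · rw [merge_even, update_of_ne h, update_of_ne (by omega), merge_even]
  · rw [merge_odd, update_of_ne (by omega), merge_odd]

/-- A function of assignments given by a term with parameters from `M`. -/
def TermDef (t : (ℕ → M.N) → M.N) : Prop :=
  ∃ (τ : Tm) (p : ℕ → M.N), ∀ e, t e = M.eval (merge e p) τ

/-- A property of assignments given by a `Σ⁰₀` formula with number parameters from `M`, the set
variables being interpreted by `E`. -/
def Sig0 (E : ℕ → Set M.N) (P : (ℕ → M.N) → Prop) : Prop :=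
  ∃ (θ : Fml) (p : ℕ → M.N), θ.IsSigma00 ∧ ∀ e, P e ↔ M.Sat θ (merge e p) E

theorem TermDef.var (i : ℕ) : TermDef (M := M) (fun e => e i) :=
  ⟨.var (2 * i), fun _ => M.zero, fun e => by simp [eval]⟩

theorem TermDef.const (c : M.N) : TermDef (M := M) (fun _ => c) :=
  ⟨.var 1, fun _ => c, fun e => by simp [eval, merge]⟩

theorem TermDef.merge (p : ℕ → M.N) (i : ℕ) : TermDef (fun e => merge e p i) :=
  ⟨.var i, p, fun _ => rfl⟩

/-- The parameter lists are packed into one: parameter `v` of the `i`-th term moves to place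
`Nat.pair i v`, and the even variables stay put. -/
theorem TermDef.exists_common {t : ℕ → (ℕ → M.N) → M.N} (h : ∀ i, TermDef (t i)) :
    ∃ (τ : ℕ → Tm) (p : ℕ → M.N), ∀ i e, t i e = M.eval (L2Structure.merge e p) (τ i) := by
  choose τ p hp using h
  refine ⟨fun i => (τ i).bind fun v => .var (if v % 2 = 0 then v else 2 * Nat.pair i (v / 2) + 1),
    fun j => p j.unpair.1 j.unpair.2, fun i e => ?_⟩
  rw [hp, eval_bind]
  congr 1
  funext v
  obtain ⟨v, rfl | rfl⟩ := Nat.even_or_odd' v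
  · simp [eval]
  · have h₁ : (2 * v + 1) % 2 = 1 := by omega
    have h₂ : (2 * v + 1) / 2 = v := by omega
    simp [eval, h₁, h₂]

theorem TermDef.comp {t : ℕ → (ℕ → M.N) → M.N} (τ : Tm) (h : ∀ i, TermDef (t i)) :
    TermDef (fun e => M.eval (fun i => t i e) τ) := by
  obtain ⟨σ, p, hp⟩ := TermDef.exists_common h
  exact ⟨τ.bind σ, p, fun e => by simp only [eval_bind, hp]⟩

theorem TermDef.comp_pair {s t : (ℕ → M.N) → M.N} (τ : Tm) (hs : TermDef s) (ht : TermDef t) :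
    TermDef (fun e => M.eval (fun i => if i = 0 then s e else t e) τ) :=
  TermDef.comp τ (t := fun i e => if i = 0 then s e else t e) fun i => by
    by_cases hi : i = 0
    · simpa [hi] using hs
    · simpa [hi] using ht

theorem Sig0.congr {P Q : (ℕ → M.N) → Prop} (h : Sig0 E P) (hPQ : ∀ e, Q e ↔ P e) : Sig0 E Q := by
  obtain ⟨θ, p, hθ, hs⟩ := h
  exact ⟨θ, p, hθ, fun e => (hPQ e).trans (hs e)⟩

theorem Sig0.sat {t : ℕ → (ℕ → M.N) → M.N} {θ : Fml} (hθ : θ.IsSigma00)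
    (h : ∀ i, TermDef (t i)) : Sig0 E (fun e => M.Sat θ (fun i => t i e) E) := by
  obtain ⟨σ, p, hp⟩ := TermDef.exists_common h
  obtain ⟨φ, hφ, hs⟩ := exists_bind (M := M) (E := E) hθ σ
  exact ⟨φ, p, hφ, fun e => by simp only [hs, hp]⟩

theorem Sig0.sat_pair {s t : (ℕ → M.N) → M.N} {θ : Fml} (hθ : θ.IsSigma00)
    (hs : TermDef s) (ht : TermDef t) :
    Sig0 E (fun e => M.Sat θ (fun i => if i = 0 then s e else t e) E) :=
  Sig0.sat hθ (t := fun i e => if i = 0 then s e else t e) fun i => by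
    by_cases hi : i = 0
    · simpa [hi] using hs
    · simpa [hi] using ht

theorem Sig0.comp {P : (ℕ → M.N) → Prop} (hP : Sig0 E P) {t : ℕ → (ℕ → M.N) → M.N}
    (h : ∀ i, TermDef (t i)) : Sig0 E (fun e => P (fun i => t i e)) := by
  obtain ⟨θ, p, hθ, hs⟩ := hP
  refine (Sig0.sat hθ (t := fun i e => L2Structure.merge (fun i => t i e) p i) fun i => ?_).congr
    fun e => hs _
  obtain ⟨i, rfl | rfl⟩ := Nat.even_or_odd' i
  · simpa using h i
  · simpa using TermDef.const (p i)

theorem Sig0.not {P : (ℕ → M.N) → Prop} (hP : Sig0 E P) : Sig0 E (fun e => ¬ P e) := by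
  obtain ⟨θ, p, hθ, hs⟩ := hP
  exact ⟨θ.neg, p, hθ.neg, fun e => not_congr (hs e)⟩

theorem Sig0.and {P Q : (ℕ → M.N) → Prop} (hP : Sig0 E P) (hQ : Sig0 E Q) :
    Sig0 E (fun e => P e ∧ Q e) := by
  obtain ⟨θ, p, hθ, hs⟩ := hP
  obtain ⟨η, q, hη, hs'⟩ := hQ
  -- Even variables go to the first formula and odd ones to the second, so the two parameter lists
  -- cannot clash.
  obtain ⟨θ', hθ', hr⟩ := exists_bind (M := M) (E := E) hθ fun i => .var (2 * i)
  obtain ⟨η', hη', hr'⟩ := exists_bind (M := M) (E := E) hη fun i => .var (2 * i + 1)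
  refine (Sig0.sat (hθ'.and hη') (t := fun i e => L2Structure.merge (L2Structure.merge e p)
    (L2Structure.merge e q) i) fun i => ?_).congr fun e => ?_
  · obtain ⟨i, rfl | rfl⟩ := Nat.even_or_odd' i
    · simpa using TermDef.merge p i
    · simpa using TermDef.merge q i
  · simp only [Sat, hr, hr', hs, hs', eval, merge_even, merge_odd]

theorem Sig0.imp {P Q : (ℕ → M.N) → Prop} (hP : Sig0 E P) (hQ : Sig0 E Q) :
    Sig0 E (fun e => P e → Q e) :=
  (hP.and hQ.not).not.congr fun e => by tauto

theorem Sig0.or {P Q : (ℕ → M.N) → Prop} (hP : Sig0 E P) (hQ : Sig0 E Q) :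
    Sig0 E (fun e => P e ∨ Q e) :=
  (hP.not.and hQ.not).not.congr fun e => by tauto

theorem Sig0.ball {t : (ℕ → M.N) → M.N} {Q : M.N → (ℕ → M.N) → Prop} (ht : TermDef t)
    (hQ : Sig0 E (fun e => Q (e 0) (fun i => e (i + 1)))) :
    Sig0 E (fun e => ∀ a, M.lt a (t e) → Q a e) := by
  obtain ⟨θ, p, hθ, hs⟩ := hQ
  obtain ⟨θ', hθ', hr⟩ := exists_bind (M := M) (E := E) hθ
    fun i => .var (if i = 0 then 0 else i + 2)
  have hsat : ∀ (a : M.N) e, Q a e ↔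
      M.Sat θ (L2Structure.merge (fun i => if i = 0 then a else e (i - 1)) p) E :=
    fun a e => by rw [← hs]; simp
  -- Variable 0 is quantified, variable 1 holds the value of the bound, and all others are shifted
  -- by two.
  refine (Sig0.sat (Fml.IsSigma00.ball 0 (.var 1) (by simp [Tm.Occurs]) hθ')
    (t := fun i e => if i = 1 then t e else L2Structure.merge (fun i => e (i - 1)) p (i - 2))
    fun i => ?_).congr fun e => ?_
  · by_cases hi : i = 1
    · simpa [hi] using ht
    · simp only [hi, if_false]
      obtain ⟨j, hj | hj⟩ := Nat.even_or_odd' (i - 2)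
      · simpa [hj] using TermDef.var (j - 1)
      · simpa [hj] using TermDef.const (p j)
  · simp only [Sat, eval, hr, update_self]
    refine forall_congr' fun a => ?_
    rw [hsat, update_of_ne one_ne_zero, if_pos rfl]
    refine imp_congr_right fun _ => ?_
    have : L2Structure.merge (fun i => if i = 0 then a else e (i - 1)) p = fun i =>
        update (fun i => if i = 1 then t e else L2Structure.merge (fun i => e (i - 1)) p (i - 2)) 0 a
          (if i = 0 then 0 else i + 2) := by
      funext i
      by_cases hi : i = 0
      · subst hi; simp [L2Structure.merge]
      · rw [if_neg hi, update_of_ne (by omega), if_neg (by omega), Nat.add_sub_cancel]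
        obtain ⟨j, rfl | rfl⟩ := Nat.even_or_odd' i
        · have : j ≠ 0 := by omega
          simp [this]
        · simp
    rw [this]

theorem Sig0.bex {t : (ℕ → M.N) → M.N} {Q : M.N → (ℕ → M.N) → Prop} (ht : TermDef t)
    (hQ : Sig0 E (fun e => Q (e 0) (fun i => e (i + 1)))) :
    Sig0 E (fun e => ∃ a, M.lt a (t e) ∧ Q a e) :=
  (Sig0.ball (Q := fun a e => ¬ Q a e) ht hQ.not).not.congr fun e => by push Not; rfl

theorem Sig0.eq {s t : (ℕ → M.N) → M.N} (hs : TermDef s) (ht : TermDef t) :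
    Sig0 E (fun e => s e = t e) :=
  Sig0.sat_pair (.eq (.var 0) (.var 1)) hs ht

theorem Sig0.mem {t : (ℕ → M.N) → M.N} (ht : TermDef t) (X : ℕ) :
    Sig0 E (fun e => t e ∈ E X) :=
  Sig0.sat_pair (.mem (.var 0) X) ht ht

theorem Sig0.app₂ {R : M.N → M.N → Prop} (hR : Sig0 E fun e => R (e 0) (e 1))
    {s t : (ℕ → M.N) → M.N} (hs : TermDef s) (ht : TermDef t) : Sig0 E (fun e => R (s e) (t e)) :=
  hR.comp (t := fun i => if i = 0 then s else t) fun i => by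
    split_ifs <;> assumption

theorem Sig0.app₃ {R : M.N → M.N → M.N → Prop} (hR : Sig0 E fun e => R (e 0) (e 1) (e 2))
    {r s t : (ℕ → M.N) → M.N} (hr : TermDef r) (hs : TermDef s) (ht : TermDef t) :
    Sig0 E (fun e => R (r e) (s e) (t e)) :=
  hR.comp (t := fun i => if i = 0 then r else if i = 1 then s else t) fun i => by
    split_ifs <;> assumption

/-! ### Semantic form of the axiom schemes -/

theorem induction_sig0 (hM : M.IsModel RCA0Star) (hE : ∀ X, E X ∈ M.S) {P : M.N → Prop}
    (hP : Sig0 E fun e => P (e 0)) (h0 : P M.zero) (hs : ∀ n, P n → P (M.add n M.one)) (n : M.N) :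
    P n := by
  obtain ⟨θ, p, hθ, h⟩ := hP
  have hP' : ∀ a, P a ↔ M.Sat θ (update (merge (fun _ => M.zero) p) 0 a) E := fun a => by
    have := merge_update (fun _ => M.zero) p 0 a
    rw [mul_zero] at this
    rw [← this, ← h]
    simp only [update_self]
  have := hM (inductionAxiom 0 θ) (.inl (.inr ⟨0, θ, hθ, rfl⟩)) (merge (fun _ => M.zero) p) E hE
  simp only [inductionAxiom, Sat] at this
  rw [sat_subst (by simp [Tm.Occurs])] at this
  simp only [sat_subst (x := 0) (r := .add (.var 0) .one) (by simp [Tm.Occurs]), eval,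
    update_self, update_idem, ← hP'] at this
  exact this ⟨h0, hs⟩ n

theorem induction_sig2 (hM : M.IsModel ISigma02) (hE : ∀ X, E X ∈ M.S)
    {R : M.N → M.N → M.N → Prop} (hR : Sig0 E fun e => R (e 0) (e 1) (e 2))
    (h0 : ∃ a, ∀ b, R M.zero a b) (hs : ∀ n, (∃ a, ∀ b, R n a b) → ∃ a, ∀ b, R (M.add n M.one) a b)
    (n : M.N) : ∃ a, ∀ b, R n a b := by
  obtain ⟨θ, p, hθ, h⟩ := hR
  have hR' : ∀ n a b, R n a b ↔
      M.Sat θ (update (update (update (merge (fun _ => M.zero) p) 0 n) 2 a) 4 b) E := by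
    intro n a b
    have := merge_update (fun _ => M.zero) p 0 n
    rw [mul_zero] at this
    rw [← this, ← merge_update _ p 1, ← merge_update _ p 2, ← h]
    simp
  -- Under `merge` the three arguments of `R` sit at the variables 0, 2 and 4.
  have := hM (inductionAxiom 0 (.exN 2 (.allN 4 θ))) ⟨0, _, ⟨2, 4, θ, hθ, rfl⟩, rfl⟩
    (merge (fun _ => M.zero) p) E hE
  simp only [inductionAxiom, Sat] at this
  rw [sat_subst (by simp [Tm.Occurs])] at this
  simp only [sat_subst (x := 0) (r := .add (.var 0) .one) (by simp [Tm.Occurs]), eval,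
    update_self, update_idem, Sat, ← hR'] at this
  exact this ⟨h0, hs⟩ n

theorem comprehension_sig0 (hM : M.IsModel RCA0Star) (hE : ∀ X, E X ∈ M.S) {P : M.N → Prop}
    (hP : Sig0 E fun e => P (e 0)) : {a | P a} ∈ M.S := by
  obtain ⟨θ, p, hθ, h⟩ := hP
  have hP' : ∀ a, P a ↔ M.Sat θ (update (merge (fun _ => M.zero) p) 0 a) E := fun a => by
    have := merge_update (fun _ => M.zero) p 0 a
    rw [mul_zero] at this
    rw [← this, ← h]
    simp only [update_self]
  obtain ⟨K, hK⟩ := M.exists_support θ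
  obtain ⟨X, hX⟩ := θ.exists_not_freeSet
  have hfresh : ∀ e E (a : M.N), M.Sat θ (update e K a) E ↔ M.Sat θ e E := fun e E a =>
    hK _ _ _ fun i hi => update_of_ne hi.ne _ _
  have hset : ∀ e A, M.Sat θ e (update E X A) ↔ M.Sat θ e E := fun e A =>
    sat_congr_set fun Y hY => update_of_ne (fun hYX => hX Y hYX.ge hY) _ _
  -- A vacuous quantifier over `K` makes `θ` both Σ⁰₁ and Π⁰₁.
  have := hM _ (.inr ⟨0, X, .exN K θ, .allN K θ, ⟨K, θ, hθ, rfl⟩, ⟨K, θ, hθ, rfl⟩, hX X le_rfl, rfl⟩)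
    (merge (fun _ => M.zero) p) E hE
  have hne : Nonempty M.N := ⟨M.zero⟩
  simp only [Sat, Fml.iff, hfresh, hset, ← hP', eval, update_self, exists_const, forall_const] at this
  obtain ⟨A, hA, hAP⟩ := this fun _ => ⟨id, id⟩
  have : {a | P a} = A := Set.ext fun a => ⟨(hAP a).2, (hAP a).1⟩
  rwa [this]

end L2Structure

namespace L2Structure

variable {M : L2Structure.{u}}

/-! ### Arithmetic in models of `RCA₀*` -/

instance : Zero M.N := ⟨M.zero⟩

instance : One M.N := ⟨M.one⟩

instance : Add M.N := ⟨M.add⟩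

instance : Mul M.N := ⟨M.mul⟩

instance : LT M.N := ⟨M.lt⟩

instance : LE M.N := ⟨fun a b => a < b ∨ a = b⟩

variable {E : ℕ → Set M.N} {s t : (ℕ → M.N) → M.N} {Q : M.N → (ℕ → M.N) → Prop}

theorem TermDef.add (hs : TermDef s) (ht : TermDef t) : TermDef (fun e => s e + t e) :=
  TermDef.comp_pair (.add (.var 0) (.var 1)) hs ht

theorem TermDef.mul (hs : TermDef s) (ht : TermDef t) : TermDef (fun e => s e * t e) :=
  TermDef.comp_pair (.mul (.var 0) (.var 1)) hs ht

theorem TermDef.exp (hs : TermDef s) (ht : TermDef t) : TermDef (fun e => M.exp (s e) (t e)) :=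
  TermDef.comp_pair (.exp (.var 0) (.var 1)) hs ht

theorem Sig0.lt (hs : TermDef s) (ht : TermDef t) : Sig0 E (fun e => s e < t e) :=
  Sig0.sat_pair (.lt (.var 0) (.var 1)) hs ht

theorem Sig0.le (hs : TermDef s) (ht : TermDef t) : Sig0 E (fun e => s e ≤ t e) :=
  (Sig0.lt hs ht).or (Sig0.eq hs ht)

theorem Sig0.ball_lt (ht : TermDef t) (hQ : Sig0 E (fun e => Q (e 0) (fun i => e (i + 1)))) :
    Sig0 E (fun e => ∀ a, a < t e → Q a e) :=
  Sig0.ball ht hQ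

theorem Sig0.bex_lt (ht : TermDef t) (hQ : Sig0 E (fun e => Q (e 0) (fun i => e (i + 1)))) :
    Sig0 E (fun e => ∃ a, a < t e ∧ Q a e) :=
  Sig0.bex ht hQ

/-- The code of an ordered pair. -/
def pairN (m n : M.N) : M.N := (m + n) * (m + n) + m

theorem TermDef.pairN (hs : TermDef s) (ht : TermDef t) :
    TermDef (fun e => pairN (s e) (t e)) :=
  .add (.mul (.add hs ht) (.add hs ht)) hs

variable [hM : Fact (M.IsModel RCA0Star)]

/-- Meant for purely arithmetical properties: the set variables still need an interpretation, and
any set of the model will do. -/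
theorem induction_param {P : M.N → Prop}
    (hP : Sig0 (fun _ => M.S_nonempty.some) fun e => P (e 0)) (h0 : P 0)
    (hs : ∀ n, P n → P (n + 1)) (n : M.N) : P n :=
  induction_sig0 hM.out (fun _ => M.S_nonempty.some_mem) hP h0 hs n

theorem sat_basic {φ : Fml} (h : φ ∈ basicAxioms ∪ expAxioms) (m n : M.N) :
    M.Sat φ (fun i => if i = 0 then m else n) (fun _ => M.S_nonempty.some) :=
  hM.out φ (.inl (.inl h)) _ _ fun _ => M.S_nonempty.some_mem

theorem succ_ne_zero' (n : M.N) : n + 1 ≠ 0 :=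
  sat_basic (φ := .neg (.eq (.add (.var 1) .one) .zero)) (by simp [basicAxioms]) n n

theorem succ_inj' {m n : M.N} (h : m + 1 = n + 1) : m = n :=
  sat_basic (φ := .imp (.eq (.add (.var 0) .one) (.add (.var 1) .one)) (.eq (.var 0) (.var 1)))
    (by simp [basicAxioms]) m n h

theorem add_zero' (m : M.N) : m + 0 = m :=
  sat_basic (φ := .eq (.add (.var 0) .zero) (.var 0)) (by simp [basicAxioms]) m m

theorem add_succ' (m n : M.N) : m + (n + 1) = m + n + 1 :=
  sat_basic (φ := .eq (.add (.var 0) (.add (.var 1) .one)) (.add (.add (.var 0) (.var 1)) .one))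
    (by simp [basicAxioms]) m n

theorem mul_zero' (m : M.N) : m * 0 = 0 :=
  sat_basic (φ := .eq (.mul (.var 0) .zero) .zero) (by simp [basicAxioms]) m m

theorem mul_succ' (m n : M.N) : m * (n + 1) = m * n + m :=
  sat_basic (φ := .eq (.mul (.var 0) (.add (.var 1) .one)) (.add (.mul (.var 0) (.var 1)) (.var 0)))
    (by simp [basicAxioms]) m n

theorem not_lt_zero' (m : M.N) : ¬ m < 0 :=
  sat_basic (φ := .neg (.lt (.var 0) .zero)) (by simp [basicAxioms]) m m

theorem lt_succ' {m n : M.N} : m < n + 1 ↔ m < n ∨ m = n := by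
  have h := sat_basic (φ := .iff (.lt (.var 0) (.add (.var 1) .one))
    (.or (.lt (.var 0) (.var 1)) (.eq (.var 0) (.var 1)))) (by simp [basicAxioms]) m n
  exact ⟨h.1, h.2⟩

theorem exp_zero (m : M.N) : M.exp m 0 = 1 :=
  sat_basic (φ := .eq (.exp (.var 0) .zero) .one) (by simp [expAxioms]) m m

theorem exp_succ (m n : M.N) : M.exp m (n + 1) = M.exp m n * m :=
  sat_basic (φ := .eq (.exp (.var 0) (.add (.var 1) .one)) (.mul (.exp (.var 0) (.var 1)) (.var 0)))
    (by simp [expAxioms]) m n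

theorem zero_add' (n : M.N) : 0 + n = n := by
  refine induction_param (P := fun n => 0 + n = n) ?_ (add_zero' 0) (fun n h => ?_) n
  · exact .eq (.add (.const _) (.var _)) (.var _)
  · rw [add_succ', h]

theorem succ_add' (m n : M.N) : m + 1 + n = m + n + 1 := by
  refine induction_param (P := fun n => m + 1 + n = m + n + 1) ?_ ?_ (fun n h => ?_) n
  · exact .eq (.add (.const _) (.var _)) (.add (.add (.const _) (.var _)) (.const _))
  · rw [add_zero', add_zero']
  · rw [add_succ', h, add_succ']

theorem add_comm' (m n : M.N) : m + n = n + m := by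
  refine induction_param (P := fun n => m + n = n + m) ?_ ?_ (fun n h => ?_) n
  · exact .eq (.add (.const _) (.var _)) (.add (.var _) (.const _))
  · rw [add_zero', zero_add']
  · rw [add_succ', h, succ_add']

theorem add_assoc' (k m n : M.N) : k + m + n = k + (m + n) := by
  refine induction_param (P := fun n => k + m + n = k + (m + n)) ?_ ?_ (fun n h => ?_) n
  · exact .eq (.add (.const _) (.var _)) (.add (.const _) (.add (.const _) (.var _)))
  · rw [add_zero', add_zero']
  · rw [add_succ', h, add_succ', add_succ']

theorem add_right_cancel_aux {k m n : M.N} (h : k + n = m + n) : k = m := by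
  refine induction_param (P := fun n => k + n = m + n → k = m) ?_ ?_ (fun n ih h => ?_) n h
  · exact .imp (.eq (.add (.const _) (.var _)) (.add (.const _) (.var _)))
      (.eq (.const _) (.const _))
  · intro h; rwa [add_zero', add_zero'] at h
  · rw [add_succ', add_succ'] at h
    exact ih (succ_inj' h)

theorem zero_mul' (n : M.N) : 0 * n = 0 := by
  refine induction_param (P := fun n => 0 * n = 0) ?_ (mul_zero' 0) (fun n h => ?_) n
  · exact .eq (.mul (.const _) (.var _)) (.const _)
  · rw [mul_succ', h, add_zero']

theorem succ_mul' (m n : M.N) : (m + 1) * n = m * n + n := by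
  refine induction_param (P := fun n => (m + 1) * n = m * n + n) ?_ ?_ (fun n h => ?_) n
  · exact .eq (.mul (.const _) (.var _)) (.add (.mul (.const _) (.var _)) (.var _))
  · rw [mul_zero', mul_zero', add_zero']
  · rw [mul_succ', h, mul_succ', add_succ', add_succ', add_assoc' _ n, add_comm' n m,
      ← add_assoc']

theorem mul_comm' (m n : M.N) : m * n = n * m := by
  refine induction_param (P := fun n => m * n = n * m) ?_ ?_ (fun n h => ?_) n
  · exact .eq (.mul (.const _) (.var _)) (.mul (.var _) (.const _))
  · rw [mul_zero', zero_mul']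
  · rw [mul_succ', h, succ_mul']

theorem left_distrib' (k m n : M.N) : k * (m + n) = k * m + k * n := by
  refine induction_param (P := fun n => k * (m + n) = k * m + k * n) ?_ ?_ (fun n h => ?_) n
  · exact .eq (.mul (.const _) (.add (.const _) (.var _)))
      (.add (.const _) (.mul (.const _) (.var _)))
  · rw [add_zero', mul_zero', add_zero']
  · rw [add_succ', mul_succ', h, mul_succ', add_assoc']

theorem mul_assoc' (k m n : M.N) : k * m * n = k * (m * n) := by
  refine induction_param (P := fun n => k * m * n = k * (m * n)) ?_ ?_ (fun n h => ?_) n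
  · exact .eq (.mul (.const _) (.var _)) (.mul (.const _) (.mul (.const _) (.var _)))
  · rw [mul_zero', mul_zero', mul_zero']
  · rw [mul_succ', h, mul_succ', left_distrib']

theorem mul_one' (m : M.N) : m * 1 = m := by
  rw [← zero_add' (1 : M.N), mul_succ', mul_zero', zero_add']

instance : CommSemiring M.N where
  add_assoc := add_assoc'
  zero_add := zero_add'
  add_zero := add_zero'
  add_comm := add_comm'
  mul_assoc := mul_assoc'
  mul_comm := mul_comm'
  one_mul m := (mul_comm' 1 m).trans (mul_one' m)
  mul_one := mul_one'
  zero_mul := zero_mul'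
  mul_zero := mul_zero'
  left_distrib := left_distrib'
  right_distrib k m n := by
    rw [mul_comm', left_distrib', mul_comm' n k, mul_comm' n m]
  nsmul := nsmulRec
  npow := npowRec

instance : IsCancelAdd M.N where
  add_left_cancel k m n h := by
    dsimp only at h
    rw [add_comm' k m, add_comm' k n] at h
    exact add_right_cancel_aux h
  add_right_cancel k m n h := add_right_cancel_aux h

/-! ### The order -/

theorem lt_trans' {k m n : M.N} (hkm : k < m) (hmn : m < n) : k < n := by
  refine induction_param (P := fun n => m < n → k < n) ?_ ?_ (fun n ih h => ?_) n hmn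
  · exact .imp (.lt (.const _) (.var _)) (.lt (.const _) (.var _))
  · exact fun h => (not_lt_zero' _ h).elim
  · rcases lt_succ'.1 h with h | rfl
    · exact lt_succ'.2 (.inl (ih h))
    · exact lt_succ'.2 (.inl hkm)

theorem succ_lt_succ' {m n : M.N} (h : m < n) : m + 1 < n + 1 := by
  refine induction_param (P := fun n => m < n → m + 1 < n + 1) ?_ ?_ (fun n ih h => ?_) n h
  · exact .imp (.lt (.const _) (.var _)) (.lt (.const _) (.add (.var _) (.const _)))
  · exact fun h => (not_lt_zero' _ h).elim
  · rcases lt_succ'.1 h with h | rfl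
    · exact lt_succ'.2 (.inl (ih h))
    · exact lt_succ'.2 (.inr rfl)

theorem zero_lt_succ' (n : M.N) : 0 < n + 1 := by
  refine induction_param (P := fun n => 0 < n + 1) ?_ ?_ (fun n h => ?_) n
  · exact .lt (.const _) (.add (.var _) (.const _))
  · exact lt_succ'.2 (.inr rfl)
  · exact lt_succ'.2 (.inl h)

theorem exists_eq_add_of_lt' {m n : M.N} (h : m < n) : ∃ d, n = m + (d + 1) := by
  -- Bounding the witness by `n` keeps the induction property Σ⁰₀.
  have : m < n → ∃ d, d < n ∧ n = m + (d + 1) := by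
    refine induction_param (P := fun n => m < n → ∃ d, d < n ∧ n = m + (d + 1)) ?_ ?_
      (fun n ih h => ?_) n
    · exact .imp (.lt (.const _) (.var _))
        (.bex_lt (.var _) (.eq (.var _) (.add (.const _) (.add (.var _) (.const _)))))
    · exact fun h => (not_lt_zero' _ h).elim
    · rcases lt_succ'.1 h with h | rfl
      · obtain ⟨d, hd, h⟩ := ih h
        exact ⟨d + 1, succ_lt_succ' hd, by rw [h]; ring⟩
      · exact ⟨0, zero_lt_succ' _, by ring⟩
  obtain ⟨d, -, hd⟩ := this h
  exact ⟨d, hd⟩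

theorem lt_add_succ' (m d : M.N) : m < m + (d + 1) := by
  refine induction_param (P := fun d => m < m + (d + 1)) ?_ ?_ (fun n h => ?_) d
  · exact .lt (.const _) (.add (.const _) (.add (.var _) (.const _)))
  · rw [zero_add]; exact lt_succ'.2 (.inr rfl)
  · rw [← add_assoc]; exact lt_succ'.2 (.inl h)

theorem lt_irrefl' (m : M.N) : ¬ m < m := fun h => by
  obtain ⟨d, hd⟩ := exists_eq_add_of_lt' h
  exact succ_ne_zero' d (add_left_cancel (a := m) (by rw [← hd, add_zero]))

theorem lt_trichotomy' (m n : M.N) : m < n ∨ m = n ∨ n < m := by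
  refine induction_param (P := fun n => m < n ∨ m = n ∨ n < m) ?_ ?_ (fun n h => ?_) n
  · exact .or (.lt (.const _) (.var _)) (.or (.eq (.const _) (.var _)) (.lt (.var _) (.const _)))
  · refine induction_param (P := fun m => m < 0 ∨ m = 0 ∨ 0 < m) ?_ (.inr (.inl rfl))
      (fun m _ => .inr (.inr (zero_lt_succ' m))) m
    exact .or (.lt (.var _) (.const _)) (.or (.eq (.var _) (.const _)) (.lt (.const _) (.var _)))
  · rcases h with h | rfl | h
    · exact .inl (lt_succ'.2 (.inl h))
    · exact .inl (lt_succ'.2 (.inr rfl))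
    · rcases lt_succ'.1 (succ_lt_succ' h) with h | h
      · exact .inr (.inr h)
      · exact .inr (.inl h.symm)

noncomputable instance : LinearOrder M.N where
  le_refl _ := .inr rfl
  le_trans a b c hab hbc := by
    rcases hab with hab | rfl
    · rcases hbc with hbc | rfl
      · exact .inl (lt_trans' hab hbc)
      · exact .inl hab
    · exact hbc
  lt_iff_le_not_ge a b := by
    constructor
    · rintro h
      refine ⟨.inl h, ?_⟩
      rintro (h' | rfl)
      · exact lt_irrefl' _ (lt_trans' h h')
      · exact lt_irrefl' _ h
    · rintro ⟨h | rfl, h'⟩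
      · exact h
      · exact (h' (.inr rfl)).elim
  le_antisymm a b := by
    rintro (h | rfl) (h' | h')
    · exact (lt_irrefl' _ (lt_trans' h h')).elim
    · exact h'.symm
    · rfl
    · rfl
  le_total a b := by
    rcases lt_trichotomy' a b with h | h | h
    · exact .inl (.inl h)
    · exact .inl (.inr h)
    · exact .inr (.inl h)
  toDecidableLE := Classical.decRel _

theorem le_iff_exists_add' {m n : M.N} : m ≤ n ↔ ∃ d, n = m + d := by
  constructor
  · rintro (h | rfl)
    · obtain ⟨d, hd⟩ := exists_eq_add_of_lt' h
      exact ⟨_, hd⟩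
    · exact ⟨0, (add_zero m).symm⟩
  · rintro ⟨d, rfl⟩
    rcases lt_trichotomy' 0 d with h | rfl | h
    · obtain ⟨c, rfl⟩ := exists_eq_add_of_lt' h
      rw [zero_add]
      exact (lt_add_succ' m c).le
    · rw [add_zero]
    · exact (not_lt_zero' _ h).elim

instance : CanonicallyOrderedAdd M.N where
  exists_add_of_le h := le_iff_exists_add'.1 h
  le_self_add _ d := le_iff_exists_add'.2 ⟨d, rfl⟩
  le_add_self _ d := le_iff_exists_add'.2 ⟨d, add_comm _ _⟩

instance : IsOrderedAddMonoid M.N where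
  add_le_add_left m n h k := by
    obtain ⟨d, rfl⟩ := le_iff_exists_add'.1 h
    exact le_iff_exists_add'.2 ⟨d, by ring⟩

instance : IsOrderedCancelAddMonoid M.N where
  le_of_add_le_add_left k m n h := by
    obtain ⟨d, hd⟩ := le_iff_exists_add'.1 h
    exact le_iff_exists_add'.2 ⟨d, add_left_cancel (hd.trans (add_assoc _ _ _))⟩

instance : Nontrivial M.N :=
  ⟨0, 1, fun h => succ_ne_zero' (0 : M.N) (by rw [zero_add, ← h])⟩

theorem exists_succ_of_pos {m : M.N} (h : 0 < m) : ∃ d, m = d + 1 := by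
  obtain ⟨d, hd⟩ := exists_eq_add_of_lt' h
  exact ⟨d, by rw [hd, zero_add]⟩

instance : NoZeroDivisors M.N where
  eq_zero_or_eq_zero_of_mul_eq_zero {a b} h := by
    by_contra hab
    push Not at hab
    obtain ⟨c, rfl⟩ := exists_succ_of_pos (pos_iff_ne_zero.2 hab.1)
    obtain ⟨d, rfl⟩ := exists_succ_of_pos (pos_iff_ne_zero.2 hab.2)
    exact succ_ne_zero' (c * d + c + d) (by rw [← h]; ring)

instance : IsStrictOrderedRing M.N :=
  { zero_le_one := zero_le
    mul_lt_mul_of_pos_left := fun a ha b c hbc => by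
      obtain ⟨d, rfl⟩ := exists_eq_add_of_lt' hbc
      rw [mul_add]
      exact lt_add_of_pos_right _
        (pos_iff_ne_zero.2 (mul_ne_zero ha.ne' (zero_lt_succ' d).ne'))
    mul_lt_mul_of_pos_right := fun a ha b c hbc => by
      obtain ⟨d, rfl⟩ := exists_eq_add_of_lt' hbc
      rw [add_mul]
      exact lt_add_of_pos_right _
        (pos_iff_ne_zero.2 (mul_ne_zero (zero_lt_succ' d).ne' ha.ne')) }

theorem lt_succ_iff' {m n : M.N} : m < n + 1 ↔ m ≤ n := lt_succ'

instance : SuccAddOrder M.N where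
  succ n := n + 1
  le_succ n := le_self_add
  max_of_succ_le h := (not_lt_of_ge h (lt_succ'.2 (.inr rfl))).elim
  succ_le_of_lt {a b} h := by
    obtain ⟨d, rfl⟩ := exists_eq_add_of_lt' h
    rw [add_comm d, ← add_assoc]
    exact le_self_add
  succ_eq_add_one _ := rfl

end L2Structure

/-! ### Least elements, pairs, division and binary digits -/

namespace L2Structure

variable {M : L2Structure.{u}} [hM : Fact (M.IsModel RCA0Star)] {E : ℕ → Set M.N}

theorem sig0_induction (hE : ∀ X, E X ∈ M.S) {P : M.N → Prop} (hP : Sig0 E fun e => P (e 0))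
    (h0 : P 0) (hs : ∀ n, P n → P (n + 1)) (n : M.N) : P n :=
  induction_sig0 hM.out hE hP h0 hs n

theorem exists_least (hE : ∀ X, E X ∈ M.S) {P : M.N → Prop} (hP : Sig0 E fun e => P (e 0))
    {a : M.N} (ha : P a) : ∃ m, P m ∧ ∀ x, x < m → ¬ P x := by
  by_contra! h
  have : ∀ n, ∀ x, x < n → ¬ P x := by
    refine sig0_induction hE (P := fun n => ∀ x, x < n → ¬ P x) ?_ ?_ fun n ih x hx hPx => ?_
    · exact .ball_lt (.var _) hP.not
    · exact fun x hx => (not_lt_zero' x hx).elim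
    · obtain ⟨y, hy, hPy⟩ := h x hPx
      exact ih y (lt_of_lt_of_le hy (lt_succ_iff'.1 hx)) hPy
  exact this (a + 1) a (lt_succ_iff'.2 le_rfl) ha

theorem eq_zero_or_eq_succ (m : M.N) : m = 0 ∨ ∃ d, m = d + 1 := by
  rcases (zero_le (a := m)).eq_or_lt with h | h
  · exact .inl h.symm
  · exact .inr (exists_succ_of_pos h)

theorem le_mul_self' (a : M.N) : a ≤ a * a := by
  rcases eq_zero_or_eq_succ a with rfl | ⟨d, rfl⟩
  · simp
  · exact le_mul_of_one_le_left' (le_add_self)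

theorem left_le_pairN (m n : M.N) : m ≤ pairN m n := le_add_self

theorem right_le_pairN (m n : M.N) : n ≤ pairN m n :=
  calc n ≤ m + n := le_add_self
    _ ≤ (m + n) * (m + n) := le_mul_self' _
    _ ≤ pairN m n := le_self_add

/-- Codes of pairs with sum `s` lie between `s²` and `s² + s < (s + 1)²`, so the code determines the
sum. -/
theorem pairN_lt_of_add_lt {m n m' n' : M.N} (h : m + n < m' + n') : pairN m n < pairN m' n' :=
  calc pairN m n ≤ (m + n) * (m + n) + (m + n) := by unfold pairN; gcongr; exact le_self_add
    _ < (m + n) * (m + n) + (m + n) + ((m + n) + 1) := lt_add_succ' _ _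
    _ = (m + n + 1) * (m + n + 1) := by ring
    _ ≤ (m' + n') * (m' + n') := by
      have := Order.add_one_le_of_lt h
      gcongr
    _ ≤ pairN m' n' := le_self_add

theorem pairN_inj {m n m' n' : M.N} (h : pairN m n = pairN m' n') : m = m' ∧ n = n' := by
  have hs : m + n = m' + n' := by
    rcases lt_trichotomy (m + n) (m' + n') with h' | h' | h'
    · exact ((pairN_lt_of_add_lt h').ne h).elim
    · exact h'
    · exact ((pairN_lt_of_add_lt h').ne' h).elim
  have hm : m = m' := by
    unfold pairN at h
    rw [hs] at h
    exact add_left_cancel h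
  subst hm
  exact ⟨rfl, add_left_cancel hs⟩

theorem exists_div (s : M.N) {d : M.N} (hd : 0 < d) : ∃ q r, r < d ∧ s = q * d + r := by
  have : ∃ q, q < s + 1 ∧ ∃ r, r < d ∧ s = q * d + r := by
    refine induction_param (P := fun s => ∃ q, q < s + 1 ∧ ∃ r, r < d ∧ s = q * d + r) ?_ ?_
      (fun s ih => ?_) s
    · exact .bex_lt (.add (.var _) (.const _)) (.bex_lt (.const _)
        (.eq (.var _) (.add (.mul (.var _) (.const _)) (.var _))))
    · exact ⟨0, zero_lt_succ' 0, 0, hd, by simp⟩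
    · obtain ⟨q, hq, r, hr, h⟩ := ih
      rcases (Order.add_one_le_of_lt hr).eq_or_lt with h' | h'
      · refine ⟨q + 1, succ_lt_succ' hq, 0, hd, ?_⟩
        rw [h, add_assoc, h']; ring
      · exact ⟨q, lt_of_lt_of_le hq le_self_add, r + 1, h', by rw [h, add_assoc]⟩
  obtain ⟨q, -, r, h⟩ := this
  exact ⟨q, r, h⟩

theorem mul_add_lt_mul {q q' r d : M.N} (hq : q < q') (hr : r < d) : q * d + r < q' * d :=
  calc q * d + r < q * d + d := by gcongr
    _ = (q + 1) * d := by ring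
    _ ≤ q' * d := by have := Order.add_one_le_of_lt hq; gcongr

theorem le_of_mul_le_mul_add {q q' r d : M.N} (hr : r < d) (h : q' * d ≤ q * d + r) : q' ≤ q :=
  not_lt.1 fun hq => not_lt.2 h (mul_add_lt_mul hq hr)

theorem div_unique {q q' r r' d : M.N} (hr : r < d) (hr' : r' < d)
    (h : q * d + r = q' * d + r') : q = q' ∧ r = r' := by
  have hq : q = q' := le_antisymm
    (le_of_mul_le_mul_add hr' (h ▸ le_self_add)) (le_of_mul_le_mul_add hr (h ▸ le_self_add))
  subst hq
  exact ⟨rfl, add_left_cancel h⟩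

theorem exp_add (m i j : M.N) : M.exp m (i + j) = M.exp m i * M.exp m j := by
  refine induction_param (P := fun j => M.exp m (i + j) = M.exp m i * M.exp m j) ?_ ?_
    (fun j ih => ?_) j
  · exact .eq (.exp (.const _) (.add (.const _) (.var _)))
      (.mul (.const _) (.exp (.const _) (.var _)))
  · rw [add_zero, exp_zero, mul_one]
  · rw [← add_assoc, exp_succ, ih, exp_succ, mul_assoc]

theorem two_exp_pos (j : M.N) : 0 < M.exp 2 j := by
  refine induction_param (P := fun j => 0 < M.exp 2 j) ?_ ?_ (fun j ih => ?_) j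
  · exact .lt (.const _) (.exp (.const _) (.var _))
  · rw [exp_zero]; exact one_pos
  · rw [exp_succ]; exact mul_pos ih two_pos

/-- The binary digit of `s` at the place `j` is `1`. -/
def Bit (s j : M.N) : Prop := ∃ q, q < s + 1 ∧ ∃ r, r < M.exp 2 j ∧ s = (2 * q + 1) * M.exp 2 j + r

theorem Sig0.bit : Sig0 E (fun e => Bit (e 0) (e 1)) :=
  .bex_lt (.add (.var _) (.const _)) (.bex_lt (.exp (.const _) (.var _))
    (.eq (.var _) (.add (.mul (.add (.mul (.const _) (.var _)) (.const _))
      (.exp (.const _) (.var _))) (.var _))))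

theorem bit_iff {s j : M.N} : Bit s j ↔ ∃ q r, r < M.exp 2 j ∧ s = (2 * q + 1) * M.exp 2 j + r := by
  refine ⟨fun ⟨q, _, h⟩ => ⟨q, h⟩, fun ⟨q, r, hr, h⟩ => ⟨q, lt_succ_iff'.2 ?_, r, hr, h⟩⟩
  calc q ≤ q + (q + 1) := le_self_add
    _ = (2 * q + 1) := by ring
    _ ≤ (2 * q + 1) * M.exp 2 j :=
      le_mul_of_one_le_right' (Order.one_le_iff_pos.2 (two_exp_pos j))
    _ ≤ s := h ▸ le_self_add

theorem exists_of_not_bit {s j : M.N} (h : ¬ Bit s j) :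
    ∃ q r, r < M.exp 2 j ∧ s = q * M.exp 2 (j + 1) + r := by
  obtain ⟨q, r, hr, hs⟩ := exists_div s (two_exp_pos j)
  obtain ⟨a, c, hc, hq⟩ := exists_div q (two_pos (α := M.N))
  refine ⟨a, r, hr, ?_⟩
  have hc' : c = 0 := by
    by_contra hc0
    have : c = 1 := by
      rw [← one_add_one_eq_two, lt_succ_iff'] at hc
      exact le_antisymm hc (Order.one_le_iff_pos.2 (pos_iff_ne_zero.2 hc0))
    exact h (bit_iff.2 ⟨a, r, hr, by rw [hs, hq, this]; ring⟩)
  rw [hs, hq, hc', exp_succ]; ring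

/-- With digit `j` absent, `s = q * 2^(j+1) + r` with `r < 2^j`; adding `2^j` leaves the remainder
below `2^(j+1)`, and `q < 2^(k-j-1)`. -/
theorem add_two_exp_lt {s j k : M.N} (hs : s < M.exp 2 k) (hj : j < k) (h : ¬ Bit s j) :
    s + M.exp 2 j < M.exp 2 k := by
  obtain ⟨q, r, hr, rfl⟩ := exists_of_not_bit h
  obtain ⟨d, rfl⟩ := le_iff_exists_add'.1 (Order.add_one_le_of_lt hj)
  rw [exp_add 2 (j + 1) d, mul_comm (M.exp 2 (j + 1))] at hs ⊢
  have hq : q < M.exp 2 d :=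
    lt_of_mul_lt_mul_right (lt_of_le_of_lt le_self_add hs) zero_le
  rw [add_assoc]
  refine mul_add_lt_mul hq ?_
  rw [exp_succ, mul_two]
  gcongr

/-- For `i < j`, `2^j` is a multiple of `2^(i+1)` and only changes the quotient by `2^(i+1)`. For `i
> j`, the absence of a carry leaves the quotient by `2^(j+1)` unchanged, and that quotient
determines digit `i`. -/
theorem bit_of_bit_add {s i j : M.N} (hij : i ≠ j) (hj : ¬ Bit s j)
    (h : Bit (s + M.exp 2 j) i) : Bit s i := by
  obtain ⟨a, r', hr', h⟩ := bit_iff.1 h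
  rcases lt_or_gt_of_ne hij with hlt | hlt
  · obtain ⟨d, rfl⟩ := le_iff_exists_add'.1 (Order.add_one_le_of_lt hlt)
    have hpow : M.exp 2 (i + 1 + d) = M.exp 2 d * (2 * M.exp 2 i) := by
      rw [exp_add, exp_succ]; ring
    rw [hpow] at h
    have hle : M.exp 2 d ≤ a := by
      have hr2 : M.exp 2 i + r' < 2 * M.exp 2 i := by
        rw [two_mul]; gcongr
      refine le_of_mul_le_mul_add hr2 ?_
      calc M.exp 2 d * (2 * M.exp 2 i) ≤ s + M.exp 2 d * (2 * M.exp 2 i) := le_add_self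
        _ = a * (2 * M.exp 2 i) + (M.exp 2 i + r') := by rw [h]; ring
    obtain ⟨c, rfl⟩ := le_iff_exists_add'.1 hle
    refine bit_iff.2 ⟨c, r', hr', add_right_cancel (h.trans ?_)⟩
    ring
  · obtain ⟨q, r, hr, rfl⟩ := exists_of_not_bit hj
    obtain ⟨d, rfl⟩ := le_iff_exists_add'.1 (Order.add_one_le_of_lt hlt)
    obtain ⟨c, r₃, hr₃, rfl⟩ := exists_div r' (two_exp_pos (j + 1))
    have hsum : r + M.exp 2 j < M.exp 2 (j + 1) := by
      rw [exp_succ, mul_two]; gcongr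
    rw [exp_add 2 (j + 1) d] at h
    obtain ⟨hq, hr₃'⟩ := div_unique (q := q) (q' := (2 * a + 1) * M.exp 2 d + c) hsum hr₃
      ((add_assoc _ _ _).symm.trans (h.trans (by ring)))
    refine bit_iff.2 ⟨a, c * M.exp 2 (j + 1) + r, lt_of_le_of_lt ?_ hr', ?_⟩
    · rw [← hr₃']
      gcongr
      exact le_self_add
    · rw [hq, exp_add 2 (j + 1) d]; ring

end L2Structure

namespace L2Structure

/-! ### The principle `ECT` in a structure -/

/-- The meaning of `ECT` in the structure `M`. -/
def ECTHolds (M : L2Structure.{u}) : Prop :=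
  ∀ k : M.N, ∀ F ∈ M.S,
    (∀ z, z ∈ F → ∃ x y, y < k ∧ z = pairN x y) → (∀ x, ∃ y, pairN x y ∈ F) →
    (∀ x y y', pairN x y ∈ F → pairN x y' ∈ F → y = y') →
    ∃ b, ∀ x, b ≤ x → ∃ y, x < y ∧ ∃ j, pairN x j ∈ F ∧ pairN y j ∈ F

variable {M : L2Structure.{u}}

theorem isTrue_ECT_iff : M.IsTrue ECT ↔ M.ECTHolds := by
  have h : ∀ e E, M.Sat ECT e E ↔ M.ECTHolds := fun e E => by
    simp [ECT, isColoring, pair, Fml.le, Sat, eval, ECTHolds]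
    rfl
  obtain ⟨A, hA⟩ := M.S_nonempty
  exact ⟨fun H => (h _ _).1 (H (fun _ => M.zero) (fun _ => A) fun _ => hA), fun H e E _ =>
    (h e E).2 H⟩

variable [hM : Fact (M.IsModel RCA0Star)] {E : ℕ → Set M.N}

/-- `ECT` for the colouring that sends `x` to the least `m` with `P x m`, where moreover each
colour that occurs from `b` on occurs unboundedly often. -/
theorem ECTHolds.exists_bound (hect : M.ECTHolds) (hE : ∀ X, E X ∈ M.S) {P : M.N → M.N → Prop}
    (hP : Sig0 E fun e => P (e 0) (e 1)) {k : M.N} (hk : ∀ x, P x k) :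
    ∃ b, ∀ x, b ≤ x → ∀ m, P x m → (∀ i, i < m → ¬ P x i) →
      ∀ c, ∃ y, c ≤ y ∧ P y m ∧ ∀ i, i < m → ¬ P y i := by
  let C : M.N → M.N → Prop := fun x m => P x m ∧ ∀ i, i < m → ¬ P x i
  have hC : Sig0 E fun e => C (e 0) (e 1) :=
    hP.and (.ball_lt (.var _) (hP.app₂ (.var _) (.var _)).not)
  have huniq : ∀ {x m m'}, C x m → C x m' → m = m' := fun {x m m'} h h' => by
    rcases lt_trichotomy m m' with hlt | heq | hlt
    · exact (h'.2 m hlt h.1).elim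
    · exact heq
    · exact (h.2 m' hlt h'.1).elim
  have hpair : ∀ {x m}, pairN x m ∈
      {z | ∃ x, x < z + 1 ∧ ∃ m, m < z + 1 ∧ z = pairN x m ∧ C x m} ↔ C x m := by
    intro x m
    constructor
    · rintro ⟨x', -, m', -, h, hC'⟩
      obtain ⟨rfl, rfl⟩ := pairN_inj h
      exact hC'
    · exact fun h => ⟨x, lt_succ_iff'.2 (left_le_pairN x m), m,
        lt_succ_iff'.2 (right_le_pairN x m), rfl, h⟩
  obtain ⟨b, hb⟩ := hect (k + 1) {z | ∃ x, x < z + 1 ∧ ∃ m, m < z + 1 ∧ z = pairN x m ∧ C x m}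
    (comprehension_sig0 hM.out hE (.bex_lt (.add (.var _) (.const _))
      (.bex_lt (.add (.var _) (.const _)) (.and (.eq (.var _) (.pairN (.var _) (.var _)))
        (hC.app₂ (.var _) (.var _))))))
    (by
      rintro z ⟨x, -, m, -, hz, hC'⟩
      exact ⟨x, m, lt_succ_iff'.2 (not_lt.1 fun hkm => hC'.2 k hkm (hk x)), hz⟩)
    (fun x => by
      obtain ⟨m, hm⟩ := exists_least hE (hP.app₂ (.const x) (.var 0)) (hk x)
      exact ⟨m, hpair.2 hm⟩)
    (fun x y y' h h' => huniq (hpair.1 h) (hpair.1 h'))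
  refine ⟨b, fun x hx m hm hm' c => ?_⟩
  by_contra! hc
  -- If colour `m` were confined below `c`, repeatedly passing to a later point of the same colour
  -- would climb past `c`; the bound `y < c` keeps this induction Σ⁰₀.
  have hex : ∀ n, ∃ y, y < c ∧ n ≤ y ∧ b ≤ y ∧ C y m := by
    have hlt : ∀ y, C y m → y < c := fun y hy => by
      by_contra! hcy
      obtain ⟨i, hi, hPi⟩ := hc y hcy hy.1
      exact hy.2 i hi hPi
    refine sig0_induction hE (P := fun n => ∃ y, y < c ∧ n ≤ y ∧ b ≤ y ∧ C y m) ?_ ?_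
      fun n ih => ?_
    · exact .bex_lt (.const _) (.and (.le (.var _) (.var _)) (.and (.le (.const _) (.var _))
        (hC.app₂ (.var _) (.const _))))
    · exact ⟨x, hlt x ⟨hm, hm'⟩, zero_le, hx, hm, hm'⟩
    · obtain ⟨y, -, hny, hby, hy⟩ := ih
      obtain ⟨y', hyy', j, hj, hj'⟩ := hb y hby
      obtain rfl := huniq (hpair.1 hj) hy
      exact ⟨y', hlt y' (hpair.1 hj'), Order.add_one_le_of_lt (lt_of_le_of_lt hny hyy'),
        hby.trans hyy'.le, hpair.1 hj'⟩
  obtain ⟨y, hyc, hcy, -⟩ := hex c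
  exact not_lt.2 hcy hyc

/-- Colour `x` by the least `m ≤ k` without a witness up to `x`, or by `k + 1`. If the colour at `b`
is `m ≤ k`, all smaller numbers have witnesses, hence so does `m`; past that witness colour `m`
cannot recur. -/
theorem ECTHolds.sigma1_induction (hect : M.ECTHolds) (hE : ∀ X, E X ∈ M.S)
    {R : M.N → M.N → Prop} (hR : Sig0 E fun e => R (e 0) (e 1)) (h0 : ∃ u, R 0 u)
    (hs : ∀ n, (∃ u, R n u) → ∃ u, R (n + 1) u) (k : M.N) : ∃ u, R k u := by
  obtain ⟨b, hb⟩ := hect.exists_bound hE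
    (P := fun x m => m = k + 1 ∨ ∀ y, y < x + 1 → ¬ R m y) (k := k + 1)
    (.or (.eq (.var _) (.const _)) (.ball_lt (.add (.var _) (.const _))
      (hR.app₂ (.var _) (.var _)).not)) (fun _ => .inl rfl)
  obtain ⟨m, hm, hleast⟩ := exists_least hE (a := k + 1)
    (P := fun m => m = k + 1 ∨ ∀ y, y < b + 1 → ¬ R m y)
    (.or (.eq (.var _) (.const _)) (.ball_lt (.const _) (hR.app₂ (.var _) (.var _)).not))
    (.inl rfl)
  have hbelow : ∀ i, i < m → ∃ u, R i u := fun i hi => by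
    have := hleast i hi
    push Not at this
    obtain ⟨-, y, -, hy⟩ := this
    exact ⟨y, hy⟩
  by_cases hmk : m = k + 1
  · exact hbelow k (hmk ▸ lt_succ_iff'.2 le_rfl)
  · exfalso
    obtain ⟨u, hu⟩ : ∃ u, R m u := by
      rcases eq_zero_or_eq_succ m with rfl | ⟨d, rfl⟩
      · exact h0
      · exact hs d (hbelow d (lt_succ_iff'.2 le_rfl))
    obtain ⟨y, hy, h | h, -⟩ := hb b le_rfl m hm hleast u
    · exact hmk h
    · exact h u (lt_succ_iff'.2 hy) hu

theorem ECTHolds.sigma2_induction (hect : M.ECTHolds) (hE : ∀ X, E X ∈ M.S)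
    {R : M.N → M.N → M.N → Prop} (hR : Sig0 E fun e => R (e 0) (e 1) (e 2))
    (h0 : ∃ x, ∀ y, R 0 x y) (hs : ∀ n, (∃ x, ∀ y, R n x y) → ∃ x, ∀ y, R (n + 1) x y) (k : M.N) :
    ∃ x, ∀ y, R k x y := by
  let D : M.N → M.N → M.N → Prop := fun n x u => ∀ x', x' < x + 1 → ∃ y, y < u + 1 ∧ ¬ R n x' y
  have hD : Sig0 E fun e => D (e 0) (e 1) (e 2) :=
    .ball_lt (.add (.var _) (.const _)) (.bex_lt (.add (.var _) (.const _))
      (hR.app₃ (.var _) (.var _) (.var _)).not)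
  have hDmono : ∀ {n x x' u u'}, x' ≤ x → u ≤ u' → D n x u → D n x' u' := by
    intro n x x' u u' hx hu h z hz
    obtain ⟨y, hy, hyR⟩ := h z (lt_of_lt_of_le hz (by gcongr))
    exact ⟨y, lt_of_lt_of_le hy (by gcongr), hyR⟩
  -- Only stages from `x` on are compared, so the event for `x` comes no earlier than `x`. This
  -- keeps events unbounded even if one stage refutes all candidates.
  let Ev : M.N → M.N → Prop := fun n u =>
    ∃ x, x < u + 1 ∧ D n x u ∧ ∀ v, v < u → x ≤ v → ¬ D n x v
  have hEv : Sig0 E fun e => Ev (e 0) (e 1) :=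
    .bex_lt (.add (.var _) (.const _)) (.and (hD.app₃ (.var _) (.var _) (.var _))
      (.ball_lt (.var _) (.imp (.le (.var _) (.var _)) (hD.app₃ (.var _) (.var _) (.var _)).not)))
  have hEvBdd : ∀ n, (∃ x, ∀ y, R n x y) → ∃ U, ∀ u, Ev n u → u ≤ U := by
    rintro n ⟨x₀, hx₀⟩
    by_cases hD0 : ∃ u, D n 0 u
    · have hstep : ∃ i, (∃ u, D n i u) ∧ ¬ ∃ u, D n (i + 1) u := by
        by_contra! h
        obtain ⟨u, hu⟩ := hect.sigma1_induction hE (R := D n)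
          (hD.app₃ (.const n) (.var 0) (.var 1)) hD0 (fun i hi => h i hi) x₀
        obtain ⟨y, -, hy⟩ := hu x₀ (lt_succ_iff'.2 le_rfl)
        exact hy (hx₀ y)
      obtain ⟨i, ⟨u₀, hu₀⟩, hi⟩ := hstep
      -- Stage `u₀ + i` refutes everything up to `i` and is at least `i`, so no event comes later.
      refine ⟨u₀ + i, fun u ⟨x, _, hxu, hleast⟩ => not_lt.1 fun hlt => ?_⟩
      have hxi : x ≤ i := not_lt.1 fun hix =>
        hi ⟨u, hDmono (Order.add_one_le_of_lt hix) le_rfl hxu⟩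
      exact hleast _ hlt (hxi.trans le_add_self) (hDmono hxi le_self_add hu₀)
    · exact ⟨0, fun u ⟨x, _, hxu, _⟩ => (hD0 ⟨u, hDmono zero_le le_rfl hxu⟩).elim⟩
  have hEvUnbdd : ∀ n, (¬ ∃ x, ∀ y, R n x y) → ∀ c, ∃ u, c ≤ u ∧ Ev n u := by
    intro n hn c
    push Not at hn
    obtain ⟨u, hu⟩ := hect.sigma1_induction hE (R := D n)
      (hD.app₃ (.const n) (.var 0) (.var 1))
      (by
        obtain ⟨y, hy⟩ := hn 0
        refine ⟨y, fun x hx => ⟨y, lt_succ_iff'.2 le_rfl, ?_⟩⟩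
        obtain rfl : x = 0 := le_antisymm (lt_succ_iff'.1 hx) zero_le
        exact hy)
      (by
        rintro x ⟨u, hu⟩
        obtain ⟨y, hy⟩ := hn (x + 1)
        refine ⟨u + y, fun x' hx' => ?_⟩
        rcases (lt_succ_iff'.1 hx').eq_or_lt with rfl | hlt
        · exact ⟨y, lt_succ_iff'.2 le_add_self, hy⟩
        · exact hDmono le_rfl le_self_add hu x' hlt) c
    obtain ⟨v, ⟨hcv, hv⟩, hleast⟩ := exists_least hE (P := fun v => c ≤ v ∧ D n c v)
      (.and (.le (.const _) (.var _)) (hD.app₃ (.const _) (.const _) (.var _)))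
      (a := u + c) ⟨le_add_self, hDmono le_rfl le_self_add hu⟩
    exact ⟨v, hcv, c, lt_succ_iff'.2 hcv, hv, fun w hw hcw hDw => hleast w hw ⟨hcw, hDw⟩⟩
  -- The default colour `k + 1` goes to every code that is not an event for some `m ≤ k`.
  let P : M.N → M.N → Prop := fun w m =>
    m = k + 1 ∨ ∃ u, u < w + 1 ∧ w = pairN m u ∧ Ev m u
  have hP : Sig0 E fun e => P (e 0) (e 1) :=
    .or (.eq (.var _) (.const _)) (.bex_lt (.add (.var _) (.const _))
      (.and (.eq (.var _) (.pairN (.var _) (.var _))) (hEv.app₂ (.var _) (.var _))))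
  have hPiff : ∀ {w m}, m ≤ k → (P w m ↔ ∃ u, w = pairN m u ∧ Ev m u) := by
    intro w m hm
    constructor
    · rintro (rfl | ⟨u, -, h⟩)
      · exact (not_lt.2 hm (lt_succ_iff'.2 le_rfl)).elim
      · exact ⟨u, h⟩
    · rintro ⟨u, rfl, h⟩
      exact .inr ⟨u, lt_succ_iff'.2 (right_le_pairN m u), rfl, h⟩
  obtain ⟨b, hb⟩ := hect.exists_bound hE hP (k := k + 1) fun _ => .inl rfl
  -- Failure at `m` becomes Σ⁰₁, with `b` as a parameter.
  have key : ∀ m, m ≤ k → ((∃ w, b ≤ w ∧ P w m) ↔ ¬ ∃ x, ∀ y, R m x y) := by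
    intro m hm
    constructor
    · rintro ⟨w, hbw, hw⟩ hφ
      obtain ⟨U, hU⟩ := hEvBdd m hφ
      obtain ⟨u, rfl, hu⟩ := (hPiff hm).1 hw
      obtain ⟨y, hy, hPy, -⟩ := hb _ hbw m hw (fun i hi hPi => by
        obtain ⟨u', h', -⟩ := (hPiff (hi.le.trans hm)).1 hPi
        exact hi.ne (pairN_inj h').1.symm) (pairN m U + 1)
      obtain ⟨v, rfl, hv⟩ := (hPiff hm).1 hPy
      refine not_lt.2 (?_ : pairN m v ≤ pairN m U) (lt_of_lt_of_le (lt_succ_iff'.2 le_rfl) hy)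
      have := hU v hv
      unfold pairN
      gcongr
    · intro hφ
      obtain ⟨u, hbu, hu⟩ := hEvUnbdd m hφ b
      exact ⟨pairN m u, hbu.trans (right_le_pairN m u), (hPiff hm).2 ⟨u, rfl, hu⟩⟩
  by_contra hk
  -- Descent from `k`: after `i` steps the failure has reached `m = k - i`, written `m + i = k`.
  obtain ⟨w, hw⟩ := hect.sigma1_induction hE
    (R := fun i w => i ≤ k → ∃ m, m < k + 1 ∧ m + i = k ∧ b ≤ w ∧ P w m)
    (.imp (.le (.var _) (.const _)) (.bex_lt (.const _) (.and
      (.eq (.add (.var _) (.var _)) (.const _)) (.and (.le (.const _) (.var _))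
        (hP.app₂ (.var _) (.var _))))))
    (by
      obtain ⟨w, hw⟩ := (key k le_rfl).2 hk
      exact ⟨w, fun _ => ⟨k, lt_succ_iff'.2 le_rfl, add_zero k, hw⟩⟩)
    (by
      rintro i ⟨w, hw⟩
      by_cases hi : i + 1 ≤ k
      · obtain ⟨m, hm, hmi, hwm⟩ := hw (le_self_add.trans hi)
        have hφ := (key m (lt_succ_iff'.1 hm)).1 ⟨w, hwm⟩
        rcases eq_zero_or_eq_succ m with rfl | ⟨d, rfl⟩
        · exact (hφ h0).elim
        · have hd : d ≤ k := le_self_add.trans (lt_succ_iff'.1 hm)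
          obtain ⟨w', hw'⟩ := (key d hd).2 fun h => hφ (hs d h)
          exact ⟨w', fun _ => ⟨d, lt_succ_iff'.2 hd, by rw [← hmi]; ring, hw'⟩⟩
      · exact ⟨w, fun h => (hi h).elim⟩) k
  obtain ⟨m, hm, hmk, hwm⟩ := hw le_rfl
  obtain rfl : m = 0 := by simpa using hmk
  exact (key 0 zero_le).1 ⟨w, hwm⟩ h0

end L2Structure

namespace L2Structure

/-! ### The equivalence -/

variable {M : L2Structure.{u}} [hM : Fact (M.IsModel RCA0Star)]

theorem ECTHolds.of_sigma2_induction (hI : M.IsModel ISigma02) : M.ECTHolds := by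
  intro k F hF hlt hex _
  by_contra! hect
  let E : ℕ → Set M.N := fun _ => F
  have hE : ∀ X, E X ∈ M.S := fun _ => hF
  -- Coding `b` and `s` by the single number `w` leaves one existential quantifier in front of the
  -- universal one.
  let R : M.N → M.N → M.N → Prop := fun n w x =>
    ∃ b, b < w + 1 ∧ ∃ s, s < w + 1 ∧ w = pairN b s ∧ n ≤ s ∧ s < M.exp 2 k ∧
      (b ≤ x → ∀ j, j < k → pairN x j ∈ E 0 → ¬ Bit s j)
  have hR : Sig0 E fun e => R (e 0) (e 1) (e 2) :=
    .bex_lt (.add (.var _) (.const _)) (.bex_lt (.add (.var _) (.const _))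
      (.and (.eq (.var _) (.pairN (.var _) (.var _))) (.and (.le (.var _) (.var _))
        (.and (.lt (.var _) (.const _)) (.imp (.le (.var _) (.var _)) (.ball_lt (.const _)
          (.imp (.mem (.pairN (.var _) (.var _)) 0) (Sig0.bit.app₂ (.var _) (.var _)).not)))))))
  have hiff : ∀ n, (∃ w, ∀ x, R n w x) ↔ ∃ b s, n ≤ s ∧ s < M.exp 2 k ∧
      ∀ x, b ≤ x → ∀ j, j < k → pairN x j ∈ F → ¬ Bit s j := by
    intro n
    constructor
    · rintro ⟨w, hw⟩
      obtain ⟨b, -, s, -, rfl, hns, hsk, -⟩ := hw 0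
      refine ⟨b, s, hns, hsk, fun x hx => ?_⟩
      obtain ⟨b', -, s', -, h, -, -, h'⟩ := hw x
      obtain ⟨rfl, rfl⟩ := pairN_inj h
      exact h' hx
    · rintro ⟨b, s, hns, hsk, h⟩
      exact ⟨pairN b s, fun x => ⟨b, lt_succ_iff'.2 (left_le_pairN b s), s,
        lt_succ_iff'.2 (right_le_pairN b s), rfl, hns, hsk, h x⟩⟩
  obtain ⟨b, s, hs, hsk, -⟩ := (hiff (M.exp 2 k)).1 <| induction_sig2 hI hE hR
    ((hiff 0).2 ⟨0, 0, le_rfl, two_exp_pos k, fun x _ j _ _ hbit => by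
      obtain ⟨q, r, -, h⟩ := bit_iff.1 hbit
      exact (add_pos_of_pos_of_nonneg (mul_pos (zero_lt_succ' _) (two_exp_pos j)) zero_le).ne h⟩)
    (fun n hn => by
      obtain ⟨b, s, hns, hsk, h⟩ := (hiff n).1 hn
      obtain ⟨x, hbx, hx⟩ := hect b
      obtain ⟨j, hj⟩ := hex x
      have hjk : j < k := by
        obtain ⟨x', j', hj', heq⟩ := hlt _ hj
        obtain ⟨-, rfl⟩ := pairN_inj heq
        exact hj'
      have hbit : ¬ Bit s j := h x hbx j hjk hj
      -- Colour `j` appears for the last time at `x`, so it joins the set and the threshold moves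
      -- just past `x`.
      refine (hiff (n + 1)).2 ⟨x + 1, s + M.exp 2 j,
        add_le_add hns (Order.one_le_iff_pos.2 (two_exp_pos j)), add_two_exp_lt hsk hjk hbit,
        fun y hy i hi hyi hb => ?_⟩
      have hxy : x < y := lt_of_lt_of_le (lt_succ_iff'.2 le_rfl) hy
      have hij : i ≠ j := by
        rintro rfl
        exact hx y hxy i hj hyi
      exact h y (hbx.trans hxy.le) i hi hyi (bit_of_bit_add hij hbit hb)) (M.exp 2 k)
  exact not_lt.2 hs hsk

theorem ECTHolds.isModel_ISigma02 (hect : M.ECTHolds) : M.IsModel ISigma02 := by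
  rintro _ ⟨z, _, ⟨x, y, θ, hθ, rfl⟩, rfl⟩ e E hE
  simp only [inductionAxiom, Sat]
  rw [sat_subst (by simp [Tm.Occurs])]
  simp only [sat_subst (x := z) (r := .add (.var z) .one) (by simp [Tm.Occurs]), eval,
    update_self, update_idem, Sat]
  rintro ⟨h0, hs⟩
  refine hect.sigma2_induction hE
    (R := fun n a b => M.Sat θ (update (update (update e z n) x a) y b) E) ?_ h0 hs
  refine Sig0.sat hθ (t := fun i e' => update (update (update e z (e' 0)) x (e' 1)) y (e' 2) i)
    fun i => ?_
  -- The variables `x`, `y`, `z` may coincide; the innermost quantifier then prevails, as in the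
  -- order of the cases.
  simp only [update_apply]
  split_ifs
  · exact .var 2
  · exact .var 1
  · exact .var 0
  · exact .const (e i)

end L2Structure

end SOA

theorem mainTheorem2 : SOA.EquivalentOver.{u} SOA.RCA0Star SOA.ISigma02 {SOA.ECT} := by
  constructor
  · rintro _ rfl M hM
    have : Fact (M.IsModel SOA.RCA0Star) := ⟨fun φ hφ => hM φ (.inl hφ)⟩
    exact SOA.L2Structure.isTrue_ECT_iff.2
      (SOA.L2Structure.ECTHolds.of_sigma2_induction fun φ hφ => hM φ (.inr hφ))
  · intro φ hφ M hM
    have : Fact (M.IsModel SOA.RCA0Star) := ⟨fun φ hφ => hM φ (.inl hφ)⟩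
    exact (SOA.L2Structure.isTrue_ECT_iff.1 (hM _ (.inr rfl))).isModel_ISigma02 φ hφ
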